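/- Let $\mathcal M=(S,\mathbf P,\mu)$ be a finite Markov chain ($S$ a finite set, $\mathbf P$ a stochastic matrix on $S$, $\mu$ a probability distribution on $S$) with random run $S_0S_1S_2\cdots$. Let $r:S\to[0,1]$ be a reward function and let $0<p\le p_{\min}$, where $p_{\min}$ is the smallest positive entry of $\mathbf P$ (in particular $p=p_{\min}$ is allowed). The mean payoff is $\mathsf{MP}:=\lim_{n\to\infty}\mathbb E\bigl[\frac1n\sum_{i=1}^n r(S_i)\bigr]$. Definitions. The graph of a finite sequence $\pi$ of states has the states of $\pi$ as vertices and the pairs of consecutive states of $\pi$ as edges. A bottom strongly connected component (BSCC) of a graph is a maximal non-empty set $C$ of vertices such that any two (possibly equal) elements of $C$ are joined by a path with at least one edge, and such that no edge leaves $C$. If the set of states of some suffix of $\pi$ is a BSCC of the graph of $\pi$, this set (there is at most one) is the candidate $K(\pi)$; otherwise $K(\pi)=\bot$. For real $k$, $C$ is a $k$-candidate of $\pi$ if $C=K(\pi)$ is the set of states of a suffix $\kappa$ of $\pi$ in which every element of $C$ occurs at least $k$ times and the last element of $\kappa$ at least $k+1$ times. $C$ is a strong $k$-candidate on $\pi$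 if $\pi=\alpha\beta b\gamma$ with $b$ a state, no state of $\alpha$ in $C$, $C$ the set of states of $\beta b\gamma$, $K(\alpha\beta)\ne C$, $K(\alpha\beta b)=C$, and $C$ is a $k$-candidate of $b\gamma$. For $\pi=s_0\cdots s_n$ let $i(\pi)$ be the length of the sequence $K(s_0),K(s_0s_1),\dots,K(s_0\cdots s_n)$ after deletion of the undefined terms and then of repetitions of consecutive terms. For $\eta>0$, $\textsc{ReachedBSCC}(\pi,p,\eta)$ answers Yes iff $i:=i(\pi)\ge1$, $K(\pi)\neq\bot$, and $K(\pi)$ is a strong $k_i$-candidate on $\pi$, where $k_i=\frac{i-\log_2\eta}{-\log_2(1-p)}$ ($k_i=0$ if $p=1$). For $\varepsilon,\delta>0$, the algorithm $\textsc{SinglePathMP}(r,p,\varepsilon,\delta)$ prolongs the path $\pi=S_0\cdots S_n$, $n=0,1,2,\dots$, and stops at the first $n$ at which $\textsc{ReachedBSCC}(\pi,p,\delta/2)$ answers Yes and $K=K(\pi)$ is a strong $k$-candidate on $\pi$, where $\varepsilon_{TP}=p\bigl((1+\varepsilon)^{1/(2|K|)}-1\bigr)$ and $k=\frac{\ln(2|K|^2)-\ln(\delta/2)}{2\varepsilon_{TP}^2}$.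 It returns the mean payoff $\hat{\mathsf{MP}}_K$ of the Markov chain on $K$ with reward $r$ and transition probabilities $\hat{\mathbf P}(s,s')$, the number of transitions from $s$ to $s'$ on $\pi$ divided by the number of occurrences of $s$ on $\pi$ that are followed by a further state. (This chain is irreducible, so its mean payoff does not depend on the initial state.) Let $X_{\mathsf{MP}}^{\varepsilon,\delta}$ be the returned value. Theorem. For all $\varepsilon_{MP},\delta>0$ the limit $\mathsf{MP}$ exists, $\textsc{SinglePathMP}(r,p,\varepsilon_{MP},\delta)$ terminates almost surely, $X_{\mathsf{MP}}^{\varepsilon_{MP},\delta}$ is integrable, and $$\mathsf{MP}-\varepsilon_{MP}-\delta\ \le\ \mathbb E\bigl[X_{\mathsf{MP}}^{\varepsilon_{MP},\delta}\bigr]\ \le\ \mathsf{MP}+\varepsilon_{MP}+\delta .$$ Consequently, if $[a,b]$ is a random interval (on any probability space) that contains $\mathbb E[X_{\mathsf{MP}}^{\varepsilon_{MP},\delta}]$ with probability at least $1-\alpha$, then $[a-\varepsilon_{MP}-\delta,\,b+\varepsilon_{MP}+\delta]$ contains $\mathsf{MP}$ with probability at least $1-\alpha$. -/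

import Mathlib

open MeasureTheory ProbabilityTheory Filter Topology

/-! ### Finite Markov chains, their runs and the mean payoff -/

/-- A Markov chain on a finite set `S` of states: a transition probability matrix `P`
and an initial distribution `μ`. -/
structure MarkovChain (S : Type*) [Fintype S] where
  P : S → S → ℝ
  P_nonneg : ∀ s t, 0 ≤ P s t
  P_sum : ∀ s, ∑ t, P s t = 1
  μ : S → ℝ
  μ_nonneg : ∀ s, 0 ≤ μ s
  μ_sum : ∑ s, μ s = 1

namespace MarkovChain

section Basic

variable {S : Type*} [Fintype S] (M : MarkovChain S)

/-- The smallest positive transition probability. -/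
noncomputable def pMin : ℝ :=
  sInf {x : ℝ | 0 < x ∧ ∃ s t, M.P s t = x}

end Basic

section Runs

variable {S : Type*} [Fintype S] [MeasurableSpace S] [DiscreteMeasurableSpace S]

/-- The measure on `S` with weights `f`. -/
noncomputable def weightMeasure (f : S → ℝ) : Measure S :=
  ∑ s, ENNReal.ofReal (f s) • Measure.dirac s

theorem weightMeasure_singleton (f : S → ℝ) (s : S) :
    weightMeasure f {s} = ENNReal.ofReal (f s) := by
  classical
  simp only [weightMeasure, Measure.coe_finsetSum, Finset.sum_apply, Measure.smul_apply,
    smul_eq_mul]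
  rw [Finset.sum_eq_single s]
  · simp
  · intro b _ hb
    simp [hb]
  · simp

theorem isProbabilityMeasure_weightMeasure {f : S → ℝ} (h0 : ∀ s, 0 ≤ f s)
    (h1 : ∑ s, f s = 1) : IsProbabilityMeasure (weightMeasure f) := by
  constructor
  simp only [weightMeasure, Measure.coe_finsetSum, Finset.sum_apply, Measure.smul_apply,
    smul_eq_mul, measure_univ, mul_one]
  rw [← ENNReal.ofReal_sum_of_nonneg (fun s _ => h0 s), h1, ENNReal.ofReal_one]

variable (M : MarkovChain S)

/-- The law of the initial state. -/
noncomputable def initialMeasure : Measure S := weightMeasure M.μ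

instance : IsProbabilityMeasure M.initialMeasure :=
  isProbabilityMeasure_weightMeasure M.μ_nonneg M.μ_sum

/-- The law of the successor of a state. -/
noncomputable def stepKernel : Kernel S S where
  toFun s := weightMeasure (M.P s)
  measurable' := Measurable.of_discrete

instance : IsMarkovKernel M.stepKernel :=
  ⟨fun s => isProbabilityMeasure_weightMeasure (M.P_nonneg s) (M.P_sum s)⟩

/-- The law of the state at time `n + 1`, given the states up to time `n`. -/
noncomputable def historyKernel (n : ℕ) : Kernel ((_ : Finset.Iic n) → S) S :=
  M.stepKernel.comap (fun h => h ⟨n, Finset.mem_Iic.2 le_rfl⟩) (measurable_pi_apply _)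

instance (n : ℕ) : IsMarkovKernel (M.historyKernel n) := by
  unfold historyKernel; infer_instance

/-- The law of the random run `s₀ s₁ s₂ …`, on the product `σ`-algebra of `ℕ → S` (the one
generated by the cones). It is concentrated on sequences all of whose transitions have positive
probability. -/
noncomputable def runMeasure : Measure (ℕ → S) :=
  Kernel.trajMeasure (X := fun _ => S) M.initialMeasure M.historyKernel

instance : IsProbabilityMeasure M.runMeasure := by
  unfold runMeasure; infer_instance

/-- The mean payoff `MP = lim_n E[(1/n) ∑_{i=1}^n r(S_i)]`. -/
noncomputable def meanPayoff (r : S → ℝ) : ℝ :=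
  limUnder atTop fun n : ℕ =>
    ∫ ρ, (1 / (n : ℝ)) * ∑ i ∈ Finset.Icc 1 n, r (ρ i) ∂M.runMeasure

end Runs

end MarkovChain

/-! ### Graphs of paths, candidates and strong candidates -/

namespace PathGraph

section Graph

variable {S : Type*}

/-- A strongly connected set of a directed graph: non-empty, and any two (possibly equal) of its
elements are joined by a path with at least one edge. A single vertex without a self-loop is not
strongly connected. -/
def IsSC (E : S → S → Prop) (C : Finset S) : Prop :=
  C.Nonempty ∧ ∀ s ∈ C, ∀ t ∈ C, Relation.TransGen E s t

/-- A bottom strongly connected component: a maximal strongly connected set without outgoing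
edges. -/
def IsBSCC (E : S → S → Prop) (C : Finset S) : Prop :=
  IsSC E C ∧ (∀ D, IsSC E D → C ⊆ D → D = C) ∧ ∀ s ∈ C, ∀ t, t ∉ C → ¬ E s t

/-- The edges of the graph of a path: the pairs of consecutive states. -/
def Edge (π : List S) (s t : S) : Prop := [s, t] <:+: π

end Graph

variable {S : Type*} [DecidableEq S]

/-- `C` is a candidate of `π`: the support of a suffix of `π` that is a BSCC of the graph
of `π`. -/
def IsCandidate (π : List S) (C : Finset S) : Prop :=
  ∃ κ : List S, κ <:+ π ∧ κ.toFinset = C ∧ IsBSCC (Edge π) C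

/-- A path has at most one candidate. -/
theorem IsCandidate.unique {π : List S} {C D : Finset S} (hC : IsCandidate π C)
    (hD : IsCandidate π D) : C = D := by
  obtain ⟨κ, ⟨a, ha⟩, rfl, hκ⟩ := hC
  obtain ⟨l, ⟨b, hb⟩, rfl, hl⟩ := hD
  have hκ0 : κ ≠ [] := by
    rintro rfl; simpa using hκ.1.1
  have hl0 : l ≠ [] := by
    rintro rfl; simpa using hl.1.1
  have hlast : κ.getLast hκ0 = l.getLast hl0 := by
    have h1 : (a ++ κ).getLast (by simp [hκ0]) = κ.getLast hκ0 :=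
      List.getLast_append_of_ne_nil _ hκ0
    have h2 : (b ++ l).getLast (by simp [hl0]) = l.getLast hl0 :=
      List.getLast_append_of_ne_nil _ hl0
    rw [← h1, ← h2]
    congr 1
    rw [ha, hb]
  have hx : κ.getLast hκ0 ∈ κ.toFinset := by simp
  have hy : κ.getLast hκ0 ∈ l.toFinset := by rw [hlast]; simp
  have hU : IsSC (Edge π) (κ.toFinset ∪ l.toFinset) := by
    refine ⟨⟨_, Finset.mem_union_left _ hx⟩, fun s hs t ht => ?_⟩
    have h1 : Relation.TransGen (Edge π) s (κ.getLast hκ0) := by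
      rcases Finset.mem_union.1 hs with h | h
      · exact hκ.1.2 _ h _ hx
      · exact hl.1.2 _ h _ hy
    have h2 : Relation.TransGen (Edge π) (κ.getLast hκ0) t := by
      rcases Finset.mem_union.1 ht with h | h
      · exact hκ.1.2 _ hx _ h
      · exact hl.1.2 _ hy _ h
    exact h1.trans h2
  rw [← hκ.2.1 _ hU Finset.subset_union_left, hl.2.1 _ hU Finset.subset_union_right]

open Classical in
/-- The candidate `K(π)` of a path, with `none` for `⊥`. -/
noncomputable def candidate (π : List S) : Option (Finset S) :=
  if h : ∃ C, IsCandidate π C then some h.choose else none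

/-- `C` is a `k`-candidate of `π`: it is the candidate of `π`, through a suffix `κ` in which every
state of `C` occurs at least `k` times and the last element at least `k + 1` times. (Thresholds
are real, since the algorithms compute real thresholds.) -/
def IsKCandidate (k : ℝ) (C : Finset S) (π : List S) : Prop :=
  ∃ κ : List S, κ <:+ π ∧ κ.toFinset = C ∧ IsBSCC (Edge π) C ∧
    (∀ s ∈ C, k ≤ (κ.count s : ℝ)) ∧ (∀ s ∈ κ.getLast?, k + 1 ≤ (κ.count s : ℝ))

/-- `C` is a strong `k`-candidate on `π`: writing `π = α β b γ`, where `α` avoids `C`, the rest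
has support `C`, and `b` is the step at which `C` becomes the candidate, `C` is a `k`-candidate
of `b γ`. -/
def IsStrongKCandidate (k : ℝ) (C : Finset S) (π : List S) : Prop :=
  ∃ (α β γ : List S) (b : S), π = α ++ β ++ b :: γ ∧ (∀ s ∈ α, s ∉ C) ∧
    (β ++ b :: γ).toFinset = C ∧
    candidate (α ++ β) ≠ some C ∧ candidate (α ++ β ++ [b]) = some C ∧
    IsKCandidate k C (b :: γ)

/-! ### The algorithms -/

/-- One iteration of the loop of `ReachedBSCC`, at the prefix `π` of the path; the state is the
pair `(C, i)`. -/
noncomputable def loopStep (Ci : Option (Finset S) × ℕ) (π : List S) :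
    Option (Finset S) × ℕ :=
  if candidate π ≠ none ∧ candidate π ≠ Ci.1 then (candidate π, Ci.2 + 1) else Ci

/-- The value of `i` after the loop of `ReachedBSCC`: the number of candidates met along
`π`, repetitions of consecutive ones not counted. -/
noncomputable def candidateIndex (π : List S) : ℕ :=
  ((List.range π.length).foldl (fun Ci j => loopStep Ci (π.take (j + 1))) (none, 0)).2

/-- The threshold `k_i = (i - log₂ δ) / (- log₂ (1 - p))`. For `p = 1` the value is `0`, which is
also the limit as `p` tends to `1`. -/
noncomputable def bsccThreshold (p δ : ℝ) (i : ℕ) : ℝ :=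
  if p = 1 then 0 else ((i : ℝ) - Real.logb 2 δ) / (- Real.logb 2 (1 - p))

/-- The algorithm `ReachedBSCC(π, p, δ)` answers `Yes`. -/
def ReachedBSCC (π : List S) (p δ : ℝ) : Prop :=
  1 ≤ candidateIndex π ∧
    ∃ K, candidate π = some K ∧ IsStrongKCandidate (bsccThreshold p δ (candidateIndex π)) K π

/-- The precision `p ((1 + ε)^{1 / (2|K|)} - 1)` required of the transition probabilities. -/
noncomputable def transPrecision (p ε : ℝ) (K : Finset S) : ℝ :=
  p * ((1 + ε) ^ (1 / (2 * (K.card : ℝ))) - 1)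

/-- The threshold `k = (ln (2|K|²) - ln (δ/2)) / (2 ε_TP²)`. -/
noncomputable def sampleThreshold (p ε δ : ℝ) (K : Finset S) : ℝ :=
  (Real.log (2 * (K.card : ℝ) ^ 2) - Real.log (δ / 2)) / (2 * transPrecision p ε K ^ 2)

/-- The exit condition of the loop of `SinglePathMP`. -/
def StopsAt (p ε δ : ℝ) (π : List S) : Prop :=
  ReachedBSCC π p (δ / 2) ∧
    ∃ K, candidate π = some K ∧ IsStrongKCandidate (sampleThreshold p ε δ K) K π

/-- The number of times that `π` takes the transition from `s` to `t`. -/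
def transCount (π : List S) (s t : S) : ℕ := (π.zip π.tail).count (s, t)

variable [Fintype S]

/-- The Markov chain with the transition probabilities estimated from `π`, started in `s₀`.
The estimate for `(s, t)` is the number of transitions from `s` to `t` on `π`, divided by the
number of transitions that leave `s`, that is, the number of occurrences of `s` followed by
a further state. A state without an observed transition gets a self-loop. From a state of the
candidate of `π`, the chain stays in the candidate, where every state has an observed transition
and where the chain is irreducible. -/
noncomputable def empiricalChain (π : List S) (s₀ : S) : MarkovChain S where
  P s t :=
    if ∑ u, transCount π s u = 0 then (if s = t then 1 else 0)
    else (transCount π s t : ℝ) / (∑ u, transCount π s u : ℕ)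
  P_nonneg s t := by split_ifs <;> positivity
  P_sum s := by
    split_ifs with h
    · simp
    · rw [← Finset.sum_div, ← Nat.cast_sum]
      exact div_self (by exact_mod_cast h)
  μ s := if s = s₀ then 1 else 0
  μ_nonneg s := by split_ifs <;> norm_num
  μ_sum := by simp

/-- The path `s₀ … s_n` of a run. -/
def pathTo (ρ : ℕ → S) (n : ℕ) : List S := (List.range (n + 1)).map ρ

/-- `SinglePathMP` terminates when the states that it draws are those of `ρ`. -/
def Terminates (p ε δ : ℝ) (ρ : ℕ → S) : Prop := ∃ n, StopsAt p ε δ (pathTo ρ n)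

variable [MeasurableSpace S] [DiscreteMeasurableSpace S]

open Classical in
/-- The output of `SinglePathMP(r, p, ε, δ)` when the states that it draws are those of `ρ`: at the
first `n` at which the loop is left, the mean payoff of the candidate with the estimated
transition probabilities, which is that of the estimated chain started in the last state of the
path. The value is `0` on runs on which the algorithm does not terminate. -/
noncomputable def singlePathMP (r : S → ℝ) (p ε δ : ℝ) (ρ : ℕ → S) : ℝ :=
  if h : Terminates p ε δ ρ then
    (empiricalChain (pathTo ρ (Nat.find h)) (ρ (Nat.find h))).meanPayoff r
  else 0

end PathGraph

/-!
The proof treats the path-dependent quantities as functions `V : List S → ℝ` of the path drawn so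
far. If `V` is non-negative and superharmonic, that is, if its conditional expectation does not
increase in any step, then Ville's inequality bounds the probability that `V` ever reaches `1` by
the initial expectation of `V` (`MarkovChain.IsSuperharmonic.measure_exists_le`). Both ways in which
the algorithm can err are controlled by such a function.

* *False candidates.* Let `p < 1`; for `p = 1` the chain is deterministic and there are no false
  candidates. While a candidate `C` that the chain can leave from the state `s` is held, each
  departure from `s` stays in `C` with probability at most `1 - p`. A weight that starts at
  `η / 2 ^ i` for the `i`-th candidate, gains the factor `1 / (1 - p)` per departure and is lost
  when `C` is left, reaches `1` when `ReachedBSCC` accepts `C`. A further weight `η / 2 ^ i` in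
  reserve pays for all later candidates (`MarkovChain.exists_isSuperharmonic_of_false_answer`). A
  candidate that has been left never returns, so every candidate has its own index.
* *Bad estimates.* The number of departures from a state at the random time at which the algorithm
  stops is itself random, so that Hoeffding's inequality for a fixed sample size is not enough. One
  of the exponential supermartingales with parameters `4 a` and `-4 a` is at least `exp (2 k a²)` at
  every time at which an estimate from at least `k` samples is off by `a`; this gives Hoeffding's
  bound uniformly in time. Weighting them by the probability of absorption in the bottom component
  `K`, which is `1` on `K`, makes the bounds for the different components add up to `δ / 2`
  (`MarkovChain.exists_isSuperharmonic_of_bad_estimate`).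

If neither error occurs, the estimated transition probabilities on a bottom component `K` have
relative errors at most `ρ`, where `(1 + ρ) ^ (2 |K|) = 1 + ε`. Replacing the rows of the
transition matrix one at a time, each replacement decreases a stationary probability at most by the
factor `(1 - ρ) / (1 + ρ)`; this is a minimum principle for the chain killed at the state whose row
is replaced. Hence the mean payoff on `K` moves by at most `ε`
(`MarkovChain.abs_ergodicLimit_sub_le`).

The limit `g` of the time averages of `r` exists because the transition operator `T` is power
bounded, so that the function space is the direct sum of the kernel and the range of `1 - T`. Since
`g` is harmonic, the expectation of `g (ρ n)` is the mean payoff for every `n`. The returned value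
differs from `g (ρ n)` by at most `ε` if the algorithm has stopped by the time `n` without an error,
and by at most `1` in any case. As the algorithm terminates almost surely, `n → ∞` gives the bound
`ε + δ`. Termination holds because almost surely the recurrent states of the run form a bottom
component all of whose transitions are taken again and again
(`MarkovChain.ae_frequently_transition`).
-/

/-! ### The transition operator and its ergodic limit -/

namespace MarkovChain

variable {S : Type*} [Fintype S] (M : MarkovChain S)

/-- The transition operator `f ↦ (s ↦ ∑ t, P s t * f t)` on functions of the state. -/
noncomputable def transition : Module.End ℝ (S → ℝ) where
  toFun f s := ∑ t, M.P s t * f t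
  map_add' f g := by
    ext s; simp [mul_add, Finset.sum_add_distrib]
  map_smul' c f := by
    ext s; simp [Finset.mul_sum, mul_left_comm]

theorem transition_apply (f : S → ℝ) (s : S) : M.transition f s = ∑ t, M.P s t * f t := rfl

theorem transition_mono {f g : S → ℝ} (h : f ≤ g) : M.transition f ≤ M.transition g := fun s =>
  Finset.sum_le_sum fun t _ => mul_le_mul_of_nonneg_left (h t) (M.P_nonneg s t)

theorem transition_const (c : ℝ) : M.transition (fun _ => c) = fun _ => c := by
  ext s
  rw [transition_apply, ← Finset.sum_mul, M.P_sum, one_mul]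

theorem transition_pow_mono {f g : S → ℝ} (h : f ≤ g) (i : ℕ) :
    (M.transition ^ i) f ≤ (M.transition ^ i) g := by
  induction i with
  | zero => simpa using h
  | succ i ih =>
    rw [pow_succ', Module.End.mul_apply, Module.End.mul_apply]
    exact M.transition_mono ih

theorem transition_pow_eq_self {f : S → ℝ} (h : M.transition f = f) (i : ℕ) :
    (M.transition ^ i) f = f := by
  induction i with
  | zero => simp
  | succ i ih => rw [pow_succ, Module.End.mul_apply, h, ih]

/-- The average of the expected values of `f` at times `1, …, n`, as a function of the initial
state. -/
noncomputable def timeAverage (f : S → ℝ) (n : ℕ) (s : S) : ℝ :=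
  (1 / (n : ℝ)) * ∑ i ∈ Finset.Icc 1 n, (M.transition ^ i) f s

theorem tendsto_timeAverage_of_harmonic {f : S → ℝ} (h : M.transition f = f) (s : S) :
    Tendsto (fun n => M.timeAverage f n s) atTop (𝓝 (f s)) := by
  apply tendsto_const_nhds.congr'
  filter_upwards [eventually_gt_atTop 0] with n hn
  simp only [timeAverage, M.transition_pow_eq_self h, Finset.sum_const, Nat.card_Icc]
  have : (n : ℝ) ≠ 0 := by positivity
  simp only [add_tsub_cancel_right, nsmul_eq_mul]
  field_simp

theorem exists_transition_pow_bound (f : S → ℝ) :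
    ∃ c, ∀ i s, |(M.transition ^ i) f s| ≤ c := by
  refine ⟨∑ s, |f s|, fun i s => ?_⟩
  have h1 : ∀ t, |f t| ≤ ∑ s, |f s| := fun t =>
    Finset.single_le_sum (f := fun s => |f s|) (fun _ _ => abs_nonneg _) (Finset.mem_univ t)
  have hu := M.transition_pow_mono (f := f) (g := fun _ => ∑ s, |f s|)
    (fun t => (le_abs_self _).trans (h1 t)) i s
  have hl := M.transition_pow_mono (g := f) (f := fun _ => -∑ s, |f s|)
    (fun t => neg_le.1 ((neg_le_abs _).trans (h1 t))) i s
  rw [M.transition_pow_eq_self (M.transition_const _)] at hu hl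
  exact abs_le.2 ⟨hl, hu⟩

theorem tendsto_timeAverage_coboundary (f : S → ℝ) (s : S) :
    Tendsto (fun n => M.timeAverage (f - M.transition f) n s) atTop (𝓝 0) := by
  obtain ⟨c, hc⟩ := M.exists_transition_pow_bound f
  have hsum : ∀ n : ℕ, ∑ i ∈ Finset.Icc 1 n, (M.transition ^ i) (f - M.transition f) s
      = (M.transition ^ 1) f s - (M.transition ^ (n + 1)) f s := by
    intro n
    induction n with
    | zero => simp
    | succ n ih =>
      rw [Finset.sum_Icc_succ_top (by omega), ih, map_sub, pow_succ _ (n + 1),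
        Module.End.mul_apply, Pi.sub_apply]
      ring
  have h0 : Tendsto (fun n : ℕ => (2 * c) / (n : ℝ)) atTop (𝓝 0) :=
    tendsto_const_div_atTop_nhds_zero_nat _
  apply squeeze_zero_norm _ h0
  intro n
  rw [timeAverage, hsum, Real.norm_eq_abs, abs_mul, abs_of_nonneg (by positivity),
    div_mul_eq_mul_div, one_mul]
  gcongr
  have h1 := abs_le.1 (hc 1 s)
  have h2 := abs_le.1 (hc (n + 1) s)
  exact abs_le.2 ⟨by linarith, by linarith⟩

/-- Every function is the sum of a harmonic function and a coboundary: a coboundary that is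
harmonic is the limit of its own time averages, which tend to `0`, so the kernel and the range of
`1 - T` are complementary by a dimension count. -/
theorem exists_harmonic_add_coboundary (f : S → ℝ) :
    ∃ g h : S → ℝ, M.transition g = g ∧ f = g + (h - M.transition h) := by
  let D : Module.End ℝ (S → ℝ) := 1 - M.transition
  have hdisj : Disjoint (LinearMap.range D) (LinearMap.ker D) := by
    rw [Submodule.disjoint_def]
    rintro _ ⟨h, rfl⟩ hk
    have hk' : M.transition (D h) = D h := (sub_eq_zero.1 (LinearMap.mem_ker.1 hk)).symm
    ext s
    exact tendsto_nhds_unique (M.tendsto_timeAverage_of_harmonic hk' s)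
      (M.tendsto_timeAverage_coboundary h s)
  have htop := Submodule.eq_top_of_disjoint _ _
    (LinearMap.finrank_range_add_finrank_ker D).ge hdisj
  have hf : f ∈ LinearMap.range D ⊔ LinearMap.ker D := htop ▸ Submodule.mem_top
  obtain ⟨_, ⟨h, rfl⟩, g, hg, hfg⟩ := Submodule.mem_sup.1 hf
  exact ⟨g, h, (sub_eq_zero.1 (LinearMap.mem_ker.1 hg)).symm, by rw [← hfg, add_comm]; rfl⟩

theorem exists_tendsto_timeAverage (f : S → ℝ) :
    ∃ g : S → ℝ, M.transition g = g ∧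
      ∀ s, Tendsto (fun n => M.timeAverage f n s) atTop (𝓝 (g s)) := by
  obtain ⟨g, h, hg, hf⟩ := M.exists_harmonic_add_coboundary f
  refine ⟨g, hg, fun s => ?_⟩
  have := (M.tendsto_timeAverage_of_harmonic hg s).add (M.tendsto_timeAverage_coboundary h s)
  rw [add_zero] at this
  convert this using 2 with n
  rw [hf]
  simp only [timeAverage, map_add, Pi.add_apply, Finset.sum_add_distrib, mul_add]

/-- The limit of the time averages of `f`, as a function of the initial state. -/
noncomputable def ergodicLimit (f : S → ℝ) : S → ℝ := (M.exists_tendsto_timeAverage f).choose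

theorem transition_ergodicLimit (f : S → ℝ) :
    M.transition (M.ergodicLimit f) = M.ergodicLimit f :=
  (M.exists_tendsto_timeAverage f).choose_spec.1

theorem tendsto_ergodicLimit (f : S → ℝ) (s : S) :
    Tendsto (fun n => M.timeAverage f n s) atTop (𝓝 (M.ergodicLimit f s)) :=
  (M.exists_tendsto_timeAverage f).choose_spec.2 s

theorem ergodicLimit_eq_self {f : S → ℝ} (h : M.transition f = f) : M.ergodicLimit f = f := by
  ext s
  exact tendsto_nhds_unique (M.tendsto_ergodicLimit f s) (M.tendsto_timeAverage_of_harmonic h s)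

theorem ergodicLimit_const (c : ℝ) : M.ergodicLimit (fun _ => c) = fun _ => c :=
  M.ergodicLimit_eq_self (M.transition_const c)

theorem ergodicLimit_mono {f g : S → ℝ} (h : f ≤ g) : M.ergodicLimit f ≤ M.ergodicLimit g :=
  fun s => le_of_tendsto_of_tendsto' (M.tendsto_ergodicLimit f s) (M.tendsto_ergodicLimit g s)
    fun n => by
      unfold timeAverage
      gcongr with i
      exact M.transition_pow_mono h i s

theorem ergodicLimit_nonneg {f : S → ℝ} (h : ∀ s, 0 ≤ f s) (s : S) : 0 ≤ M.ergodicLimit f s := by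
  have := M.ergodicLimit_mono (f := fun _ => 0) (g := f) h s
  rwa [ergodicLimit_const] at this

theorem ergodicLimit_le_one {f : S → ℝ} (h : ∀ s, f s ≤ 1) (s : S) : M.ergodicLimit f s ≤ 1 := by
  have := M.ergodicLimit_mono (f := f) (g := fun _ => 1) h s
  rwa [ergodicLimit_const] at this

theorem ergodicLimit_sum {ι : Type*} (A : Finset ι) (c : ι → ℝ) (f : ι → S → ℝ) (s : S) :
    M.ergodicLimit (fun t => ∑ j ∈ A, c j * f j t) s = ∑ j ∈ A, c j * M.ergodicLimit (f j) s := by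
  refine tendsto_nhds_unique (M.tendsto_ergodicLimit _ s) ?_
  have : Tendsto (fun n => ∑ j ∈ A, c j * M.timeAverage (f j) n s) atTop
      (𝓝 (∑ j ∈ A, c j * M.ergodicLimit (f j) s)) :=
    tendsto_finsetSum _ fun j _ => (M.tendsto_ergodicLimit (f j) s).const_mul _
  refine this.congr fun n => ?_
  have hsum : (fun t => ∑ j ∈ A, c j * f j t) = ∑ j ∈ A, c j • f j := by
    ext t; simp
  simp only [timeAverage, hsum, map_sum, map_smul, Finset.sum_apply, Pi.smul_apply, smul_eq_mul]
  rw [Finset.sum_comm, Finset.mul_sum]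
  refine Finset.sum_congr rfl fun j _ => ?_
  rw [← Finset.mul_sum]
  ring

theorem ergodicLimit_transition (f : S → ℝ) :
    M.ergodicLimit (M.transition f) = M.ergodicLimit f := by
  ext s
  refine tendsto_nhds_unique (M.tendsto_ergodicLimit _ s) ?_
  have := (M.tendsto_ergodicLimit f s).sub (M.tendsto_timeAverage_coboundary f s)
  rw [sub_zero] at this
  refine this.congr fun n => ?_
  simp only [timeAverage, map_sub, Pi.sub_apply, Finset.sum_sub_distrib]
  ring

/-! ### Stationary distributions -/

section Stationary

variable [DecidableEq S]

/-- The long-run frequency of `t` for the chain started in `s`. -/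
noncomputable def frequency (s t : S) : ℝ := M.ergodicLimit (Pi.single t 1) s

theorem sum_mul_single (f : S → ℝ) : (fun u => ∑ t, f t * (Pi.single t 1 : S → ℝ) u) = f := by
  ext u
  simp [Pi.single_apply]

theorem ergodicLimit_eq_sum (f : S → ℝ) (s : S) :
    M.ergodicLimit f s = ∑ t, M.frequency s t * f t := by
  conv_lhs => rw [← sum_mul_single f]
  rw [ergodicLimit_sum]
  exact Finset.sum_congr rfl fun t _ => mul_comm _ _

theorem frequency_nonneg (s t : S) : 0 ≤ M.frequency s t :=
  M.ergodicLimit_nonneg (fun u => by rw [Pi.single_apply]; split_ifs <;> norm_num) s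

theorem sum_frequency (s : S) : ∑ t, M.frequency s t = 1 := by
  have := M.ergodicLimit_eq_sum (fun _ => 1) s
  rw [ergodicLimit_const] at this
  simpa using this.symm

theorem frequency_stationary (s u : S) : ∑ t, M.frequency s t * M.P t u = M.frequency s u := by
  have h := M.ergodicLimit_eq_sum (M.transition (Pi.single u 1)) s
  rw [ergodicLimit_transition] at h
  rw [frequency, h]
  refine Finset.sum_congr rfl fun t _ => ?_
  simp [transition_apply, Pi.single_apply]

end Stationary

/-! ### Closed sets of states -/

/-- A set of states that the chain cannot leave. -/
def IsClosedSet (K : Finset S) : Prop := ∀ s ∈ K, ∀ t, t ∉ K → M.P s t = 0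

variable {M}

theorem IsClosedSet.sum_eq {K : Finset S} (hK : M.IsClosedSet K) {s : S} (hs : s ∈ K)
    (f : S → ℝ) : ∑ t ∈ K, M.P s t * f t = ∑ t, M.P s t * f t :=
  Finset.sum_subset (Finset.subset_univ K) fun t _ ht => by rw [hK s hs t ht, zero_mul]

theorem IsClosedSet.transition_pow_congr {K : Finset S} (hK : M.IsClosedSet K) {f g : S → ℝ}
    (hfg : ∀ s ∈ K, f s = g s) (i : ℕ) :
    ∀ s ∈ K, (M.transition ^ i) f s = (M.transition ^ i) g s := by
  induction i with
  | zero => simpa using hfg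
  | succ i ih =>
    intro s hs
    rw [pow_succ', Module.End.mul_apply, Module.End.mul_apply, transition_apply, transition_apply,
      ← hK.sum_eq hs, ← hK.sum_eq hs]
    exact Finset.sum_congr rfl fun t ht => by rw [ih t ht]

theorem IsClosedSet.ergodicLimit_congr {K : Finset S} (hK : M.IsClosedSet K) {f g : S → ℝ}
    (hfg : ∀ s ∈ K, f s = g s) {s : S} (hs : s ∈ K) :
    M.ergodicLimit f s = M.ergodicLimit g s := by
  refine tendsto_nhds_unique (M.tendsto_ergodicLimit f s)
    ((M.tendsto_ergodicLimit g s).congr fun n => ?_)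
  simp only [timeAverage]
  congr 1
  exact Finset.sum_congr rfl fun i _ => (hK.transition_pow_congr hfg i s hs).symm

theorem IsClosedSet.frequency_eq_zero [DecidableEq S] {K : Finset S} (hK : M.IsClosedSet K)
    {s t : S} (hs : s ∈ K) (ht : t ∉ K) : M.frequency s t = 0 := by
  rw [frequency, hK.ergodicLimit_congr (g := fun _ => 0) (fun u hu => ?_) hs, ergodicLimit_const]
  rw [Pi.single_apply, if_neg (fun h : u = t => ht (h ▸ hu))]

end MarkovChain

/-! ### Perturbation of stationary distributions -/

namespace MarkovChain

variable {S : Type*} [Fintype S] {M M' : MarkovChain S}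

theorem sum_sum_mul_P (M : MarkovChain S) (y : S → ℝ) :
    ∑ u, ∑ v, y v * M.P v u = ∑ v, y v := by
  rw [Finset.sum_comm]
  exact Finset.sum_congr rfl fun v _ => by rw [← Finset.mul_sum, M.P_sum, mul_one]

/-- The support of a subinvariant non-negative measure is closed under transitions: its total mass
is preserved, so the measure is invariant. -/
theorem pos_of_subinvariant {y : S → ℝ} (hy : ∀ v, 0 ≤ y v)
    (hsub : ∀ u, y u ≤ ∑ v, y v * M.P v u) {v w : S} (hv : 0 < y v)
    (hvw : Relation.ReflTransGen (fun s t => 0 < M.P s t) v w) : 0 < y w := by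
  have hinv : ∀ u, y u = ∑ v, y v * M.P v u := fun u =>
    (Finset.sum_eq_sum_iff_of_le fun u _ => hsub u).1 (M.sum_sum_mul_P y).symm u (Finset.mem_univ u)
  induction hvw with
  | refl => exact hv
  | @tail b c _ hbc ih =>
    rw [hinv c]
    exact (mul_pos ih hbc).trans_le
      (Finset.single_le_sum (f := fun v => y v * M.P v c)
        (fun v _ => mul_nonneg (hy v) (M.P_nonneg v c)) (Finset.mem_univ b))

/-- A minimum principle for the chain killed at `s`: a signed measure that is superinvariant off
`s` and non-negative at `s` is non-negative, provided that `s` is reached from wherever the measure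
lives. -/
theorem nonneg_of_superinvariant_off [DecidableEq S] {K : Finset S} {s : S}
    (hreach : ∀ v ∈ K, Relation.ReflTransGen (fun s t => 0 < M.P s t) v s)
    {d : S → ℝ} (hK : ∀ v, v ∉ K → d v = 0) (hs : 0 ≤ d s)
    (hsup : ∀ u, u ≠ s → ∑ v ∈ Finset.univ.erase s, d v * M.P v u ≤ d u) (u : S) : 0 ≤ d u := by
  by_contra! hu
  let y : S → ℝ := fun v => max (-d v) 0
  have hy : ∀ v, 0 ≤ y v := fun v => le_max_right _ _
  have hys : y s = 0 := max_eq_right (by linarith)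
  have hyP : ∀ w, 0 ≤ ∑ v, y v * M.P v w := fun w =>
    Finset.sum_nonneg fun v _ => mul_nonneg (hy v) (M.P_nonneg v w)
  have hsub : ∀ w, y w ≤ ∑ v, y v * M.P v w := by
    intro w
    rcases eq_or_ne w s with rfl | hw
    · rw [hys]; exact hyP w
    · refine max_le ?_ (hyP w)
      rw [← Finset.sum_erase (f := fun v => y v * M.P v w) (a := s) Finset.univ
        (by simp only [hys, zero_mul])]
      calc -d w ≤ -∑ v ∈ Finset.univ.erase s, d v * M.P v w := neg_le_neg (hsup w hw)
        _ = ∑ v ∈ Finset.univ.erase s, -d v * M.P v w := by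
          rw [← Finset.sum_neg_distrib]
          exact Finset.sum_congr rfl fun v _ => (neg_mul _ _).symm
        _ ≤ _ := Finset.sum_le_sum fun v _ =>
          mul_le_mul_of_nonneg_right (le_max_left _ _) (M.P_nonneg v w)
  have huK : u ∈ K := by
    by_contra h
    rw [hK u h] at hu
    exact lt_irrefl _ hu
  have := pos_of_subinvariant hy hsub (lt_max_of_lt_left (by linarith) : 0 < y u) (hreach u huK)
  linarith

/-- `x` is a stationary distribution of `M` that is concentrated on `K`. -/
structure IsStationaryOn (M : MarkovChain S) (K : Finset S) (x : S → ℝ) : Prop where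
  nonneg : ∀ s, 0 ≤ x s
  sum_eq : ∑ s, x s = 1
  eq_zero : ∀ s, s ∉ K → x s = 0
  invariant : ∀ u, ∑ v, x v * M.P v u = x u

theorem IsClosedSet.isStationaryOn_frequency [DecidableEq S] {K : Finset S}
    (hK : M.IsClosedSet K) {s : S} (hs : s ∈ K) : M.IsStationaryOn K (M.frequency s) :=
  ⟨M.frequency_nonneg s, M.sum_frequency s, fun _ ht => hK.frequency_eq_zero hs ht,
    M.frequency_stationary s⟩

/-- Any state of `K` is reached from any other one. -/
def IsIrreducibleOn (M : MarkovChain S) (K : Finset S) : Prop :=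
  ∀ s ∈ K, ∀ t ∈ K, Relation.ReflTransGen (fun s t => 0 < M.P s t) s t

theorem IsStationaryOn.pos {K : Finset S} {x : S → ℝ} (hx : M.IsStationaryOn K x)
    (hK : M.IsIrreducibleOn K) {v : S} (hv : v ∈ K) : 0 < x v := by
  obtain ⟨u, -, hu⟩ : ∃ u ∈ Finset.univ, 0 < x u := by
    by_contra! h
    have := Finset.sum_nonpos h
    rw [hx.sum_eq] at this
    linarith
  have huK : u ∈ K := by
    by_contra h
    rw [hx.eq_zero u h] at hu
    exact lt_irrefl _ hu
  exact pos_of_subinvariant hx.nonneg (fun w => (hx.invariant w).ge) hu (hK u huK v hv)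

/-- Comparison of the stationary measures of two chains that differ in the row of `s` only. -/
theorem IsStationaryOn.comparison [DecidableEq S] {K : Finset S} {x x' : S → ℝ} {s : S}
    (hK : M.IsIrreducibleOn K) (hs : s ∈ K) (hrow : ∀ v, v ≠ s → ∀ u, M'.P v u = M.P v u)
    (hx : M.IsStationaryOn K x) (hx' : M'.IsStationaryOn K x') {α β : ℝ}
    (h0 : 0 ≤ α * x s + β * x' s) (h1 : ∀ u, 0 ≤ α * x s * M.P s u + β * x' s * M'.P s u) (u : S) :
    0 ≤ α * x u + β * x' u := by
  refine nonneg_of_superinvariant_off (M := M) (d := fun u => α * x u + β * x' u)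
    (fun v hv => hK v hv s hs) (fun v hv => by simp [hx.eq_zero v hv, hx'.eq_zero v hv]) h0
    (fun u _ => ?_) u
  have e : α * x u + β * x' u = ∑ v, (α * x v * M.P v u + β * x' v * M'.P v u) := by
    rw [← hx.invariant u, ← hx'.invariant u, Finset.mul_sum, Finset.mul_sum,
      ← Finset.sum_add_distrib]
    exact Finset.sum_congr rfl fun v _ => by ring
  have e2 := Finset.sum_erase_add Finset.univ (fun v => α * x v * M.P v u + β * x' v * M'.P v u)
    (Finset.mem_univ s)
  have e3 : ∑ v ∈ Finset.univ.erase s, (α * x v + β * x' v) * M.P v u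
      = ∑ v ∈ Finset.univ.erase s, (α * x v * M.P v u + β * x' v * M'.P v u) :=
    Finset.sum_congr rfl fun v hv => by rw [hrow v (Finset.ne_of_mem_erase hv)]; ring
  rw [e, e3, ← e2]
  linarith [h1 u]

/-- If one row changes by relative errors at most `ρ`, then no stationary probability decreases by
more than the factor `(1 - ρ) / (1 + ρ)`. -/
theorem IsStationaryOn.le_of_row [DecidableEq S] {K : Finset S} {x x' : S → ℝ} {s : S} {ρ : ℝ}
    (hK : M.IsIrreducibleOn K) (hs : s ∈ K) (hrow : ∀ v, v ≠ s → ∀ u, M'.P v u = M.P v u)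
    (hρ : 0 ≤ ρ) (hlo : ∀ u, (1 - ρ) * M.P s u ≤ M'.P s u)
    (hhi : ∀ u, M'.P s u ≤ (1 + ρ) * M.P s u)
    (hx : M.IsStationaryOn K x) (hx' : M'.IsStationaryOn K x') (v : S) :
    (1 - ρ) * x v ≤ (1 + ρ) * x' v := by
  have ha : 0 < x s := hx.pos hK hs
  have hb : 0 ≤ x' s := hx'.nonneg s
  have hup : ∀ u, 0 ≤ (1 + ρ) * x' s * x u + -x s * x' u := fun u => by
    refine IsStationaryOn.comparison hK hs hrow hx hx' ?_ (fun u => ?_) u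
    · have := mul_nonneg hρ (mul_nonneg ha.le hb)
      linarith
    · have := mul_le_mul_of_nonneg_left (hhi u) (mul_nonneg ha.le hb)
      linarith
  have hdown : ∀ u, 0 ≤ -((1 - ρ) * x' s) * x u + x s * x' u := fun u => by
    refine IsStationaryOn.comparison hK hs hrow hx hx' ?_ (fun u => ?_) u
    · have := mul_nonneg hρ (mul_nonneg ha.le hb)
      linarith
    · have := mul_le_mul_of_nonneg_left (hlo u) (mul_nonneg ha.le hb)
      linarith
  -- Summing the upper bound over all states compares the normalizing constants.
  have hab : x s ≤ (1 + ρ) * x' s := by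
    have := Finset.sum_nonneg fun u (_ : u ∈ Finset.univ) => hup u
    rw [Finset.sum_add_distrib, ← Finset.mul_sum, ← Finset.mul_sum, hx.sum_eq, hx'.sum_eq] at this
    linarith
  have h2 := hdown v
  have h3 := mul_le_mul_of_nonneg_right hab (hx'.nonneg v)
  rcases hb.eq_or_lt with hb0 | hb0
  · rw [← hb0] at hab
    linarith
  · refine le_of_mul_le_mul_left ?_ hb0
    linarith

/-- The chain `M` with the rows in `A` replaced by those of `M'`. -/
noncomputable def replaceRows [DecidableEq S] (M M' : MarkovChain S) (A : Finset S) :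
    MarkovChain S where
  P s t := if s ∈ A then M'.P s t else M.P s t
  P_nonneg s t := by split_ifs; exacts [M'.P_nonneg s t, M.P_nonneg s t]
  P_sum s := by split_ifs; exacts [M'.P_sum s, M.P_sum s]
  μ := M.μ
  μ_nonneg := M.μ_nonneg
  μ_sum := M.μ_sum

theorem IsStationaryOn.le_of_rows [DecidableEq S] {K : Finset S} {x : S → ℝ} {ρ : ℝ}
    (hne : K.Nonempty) (hK : M.IsIrreducibleOn K) (hcl : M.IsClosedSet K) (hρ : 0 ≤ ρ)
    (hρ1 : ρ < 1)
    (hlo : ∀ s ∈ K, ∀ u, (1 - ρ) * M.P s u ≤ M'.P s u)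
    (hhi : ∀ s ∈ K, ∀ u, M'.P s u ≤ (1 + ρ) * M.P s u)
    (hx : M.IsStationaryOn K x) (A : Finset S) (hA : A ⊆ K) :
    ∀ x', (M.replaceRows M' A).IsStationaryOn K x' →
      ∀ v, (1 - ρ) ^ A.card * x v ≤ (1 + ρ) ^ A.card * x' v := by
  obtain ⟨s₀, hs₀⟩ := hne
  have hcl' : M'.IsClosedSet K := fun s hs t ht => le_antisymm
    (by simpa [hcl s hs t ht] using hhi s hs t) (M'.P_nonneg s t)
  induction A using Finset.induction_on with
  | empty =>
    intro x' hx' v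
    simpa using IsStationaryOn.le_of_row (M := M) (M' := M.replaceRows M' ∅) (ρ := 0) hK hs₀
      (fun v _ u => by simp [replaceRows]) le_rfl (by simp [replaceRows]) (by simp [replaceRows])
      hx hx' v
  | insert s A hsA ih =>
    intro x' hx' v
    have hsK : s ∈ K := hA (Finset.mem_insert_self s A)
    have hAK : A ⊆ K := (Finset.subset_insert s A).trans hA
    have hclA : (M.replaceRows M' A).IsClosedSet K := fun u hu t ht => by
      simp only [replaceRows]
      split_ifs
      exacts [hcl' u hu t ht, hcl u hu t ht]
    have hirr : (M.replaceRows M' A).IsIrreducibleOn K := fun u hu t ht => by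
      refine Relation.ReflTransGen.mono (fun a b hab => ?_) _ _ (hK u hu t ht)
      simp only [replaceRows]
      split_ifs with h
      · exact (mul_pos (by linarith) hab).trans_le (hlo a (hAK h) b)
      · exact hab
    have hy := hclA.isStationaryOn_frequency hs₀
    have h1 := ih hAK _ hy v
    have h2 := IsStationaryOn.le_of_row (M := M.replaceRows M' A)
      (M' := M.replaceRows M' (insert s A)) (s := s) (ρ := ρ) hirr hsK
      (fun v hv u => by simp [replaceRows, hv]) hρ
      (fun u => by simpa [replaceRows, hsA] using hlo s hsK u)
      (fun u => by simpa [replaceRows, hsA] using hhi s hsK u) hy hx' v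
    rw [Finset.card_insert_of_notMem hsA, pow_succ, pow_succ]
    have h3 := mul_le_mul_of_nonneg_left h1 (by linarith : 0 ≤ 1 - ρ)
    have h4 := mul_le_mul_of_nonneg_left h2 (by positivity : 0 ≤ (1 + ρ) ^ A.card)
    nlinarith

/-- Relative errors at most `ρ` in the transition probabilities of a bottom component with `n`
states change its mean payoff by at most `(1 + ρ) ^ (2 n) - 1`. -/
theorem abs_ergodicLimit_sub_le [DecidableEq S] {K : Finset S} {ρ : ℝ}
    (hK : M.IsIrreducibleOn K) (hcl : M.IsClosedSet K) (hρ : 0 ≤ ρ) (hρ1 : ρ < 1)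
    (hlo : ∀ s ∈ K, ∀ u, (1 - ρ) * M.P s u ≤ M'.P s u)
    (hhi : ∀ s ∈ K, ∀ u, M'.P s u ≤ (1 + ρ) * M.P s u)
    {r : S → ℝ} (hr : ∀ s, r s ∈ Set.Icc (0 : ℝ) 1) {s s' : S} (hs : s ∈ K) (hs' : s' ∈ K) :
    |M'.ergodicLimit r s' - M.ergodicLimit r s| ≤ (1 + ρ) ^ (2 * K.card) - 1 := by
  have hcl' : M'.IsClosedSet K := fun s hs t ht => le_antisymm
    (by simpa [hcl s hs t ht] using hhi s hs t) (M'.P_nonneg s t)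
  have hx := hcl.isStationaryOn_frequency hs
  have hx' := hcl'.isStationaryOn_frequency hs'
  have hx'' : (M.replaceRows M' K).IsStationaryOn K (M'.frequency s') := by
    refine ⟨hx'.nonneg, hx'.sum_eq, hx'.eq_zero, fun u => ?_⟩
    rw [← hx'.invariant u]
    refine Finset.sum_congr rfl fun v _ => ?_
    by_cases hv : v ∈ K
    · simp [replaceRows, hv]
    · rw [hx'.eq_zero v hv, zero_mul, zero_mul]
  set q : ℝ := ((1 - ρ) / (1 + ρ)) ^ K.card with hq
  have hle : ∀ v, q * M.frequency s v ≤ M'.frequency s' v := fun v => by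
    have := IsStationaryOn.le_of_rows ⟨s, hs⟩ hK hcl hρ hρ1 hlo hhi hx K subset_rfl _ hx'' v
    rw [hq, div_pow, div_mul_eq_mul_div, div_le_iff₀ (by positivity)]
    linarith
  have hq1 : 1 - q ≤ (1 + ρ) ^ (2 * K.card) - 1 := by
    have h1 := one_add_mul_le_pow (a := -(2 * ρ / (1 + ρ))) (by
      rw [neg_le_neg_iff, div_le_iff₀ (by linarith)]; linarith) K.card
    have h2 := one_add_mul_le_pow (a := ρ) (by linarith) (2 * K.card)
    have h3 : 1 + -(2 * ρ / (1 + ρ)) = (1 - ρ) / (1 + ρ) := by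
      have : 1 + ρ ≠ 0 := by positivity
      field_simp
      ring
    have h4 : 2 * ρ / (1 + ρ) ≤ 2 * ρ := div_le_self (by linarith) (by linarith)
    have h5 := mul_le_mul_of_nonneg_left h4 (Nat.cast_nonneg (α := ℝ) K.card)
    rw [h3, ← hq] at h1
    push_cast at h2
    linarith
  have hq0 : q ≤ 1 := pow_le_one₀ (div_nonneg (by linarith) (by linarith))
    ((div_le_one (by linarith)).2 (by linarith))
  have hbound : ∀ f : S → ℝ, (∀ s, f s ∈ Set.Icc (0 : ℝ) 1) →
      M.ergodicLimit f s - M'.ergodicLimit f s' ≤ 1 - q := by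
    intro f hf
    have h1 : q * M.ergodicLimit f s ≤ M'.ergodicLimit f s' := by
      rw [ergodicLimit_eq_sum, ergodicLimit_eq_sum, Finset.mul_sum]
      refine Finset.sum_le_sum fun v _ => ?_
      rw [← mul_assoc]
      exact mul_le_mul_of_nonneg_right (hle v) (hf v).1
    have h2 := mul_le_mul_of_nonneg_left (M.ergodicLimit_le_one (fun s => (hf s).2) s)
      (by linarith : 0 ≤ 1 - q)
    linarith
  have hcompl : ∀ (N : MarkovChain S) (s : S),
      N.ergodicLimit (fun t => 1 - r t) s = 1 - N.ergodicLimit r s := fun N s => by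
    simp only [ergodicLimit_eq_sum, mul_sub, Finset.sum_sub_distrib, mul_one, N.sum_frequency]
  have h1 := hbound r hr
  have h2 := hbound (fun t => 1 - r t) fun s => ⟨by linarith [(hr s).2], by linarith [(hr s).1]⟩
  rw [hcompl, hcompl] at h2
  exact abs_le.2 ⟨by linarith, by linarith⟩

end MarkovChain

/-! ### Superharmonic functions of the path -/

namespace MarkovChain

variable {S : Type*} [Fintype S] {M : MarkovChain S}

/-- A non-negative function of the path whose conditional expectation does not increase when
the chain takes a step. -/
structure IsSuperharmonic (M : MarkovChain S) (V : List S → ℝ) : Prop where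
  nonneg : ∀ π, 0 ≤ V π
  step : ∀ π s, ∑ t, M.P s t * V (π ++ [s] ++ [t]) ≤ V (π ++ [s])

theorem IsSuperharmonic.add {V W : List S → ℝ} (hV : M.IsSuperharmonic V)
    (hW : M.IsSuperharmonic W) : M.IsSuperharmonic fun π => V π + W π where
  nonneg π := add_nonneg (hV.nonneg π) (hW.nonneg π)
  step π s := by
    simp only [mul_add, Finset.sum_add_distrib]
    exact add_le_add (hV.step π s) (hW.step π s)

theorem IsSuperharmonic.const_mul {V : List S → ℝ} (hV : M.IsSuperharmonic V) {c : ℝ}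
    (hc : 0 ≤ c) : M.IsSuperharmonic fun π => c * V π where
  nonneg π := mul_nonneg hc (hV.nonneg π)
  step π s := by
    simp only [mul_left_comm _ c, ← Finset.mul_sum]
    exact mul_le_mul_of_nonneg_left (hV.step π s) hc

theorem IsSuperharmonic.sum {ι : Type*} {A : Finset ι} {V : ι → List S → ℝ}
    (hV : ∀ j ∈ A, M.IsSuperharmonic (V j)) : M.IsSuperharmonic fun π => ∑ j ∈ A, V j π where
  nonneg π := Finset.sum_nonneg fun j hj => (hV j hj).nonneg π
  step π s := by
    simp only [Finset.mul_sum]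
    rw [Finset.sum_comm]
    exact Finset.sum_le_sum fun j hj => (hV j hj).step π s

end MarkovChain

/-! ### Expectations along the run -/

namespace PathGraph

variable {S : Type*}

theorem pathTo_zero (ρ : ℕ → S) : pathTo ρ 0 = [ρ 0] := rfl

theorem pathTo_eq_append (ρ : ℕ → S) (n : ℕ) :
    pathTo ρ n = (List.range n).map ρ ++ [ρ n] := by
  simp [pathTo, List.range_succ]

theorem pathTo_succ (ρ : ℕ → S) (n : ℕ) : pathTo ρ (n + 1) = pathTo ρ n ++ [ρ (n + 1)] := by
  simp [pathTo, List.range_succ]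

theorem pathTo_ne_nil (ρ : ℕ → S) (n : ℕ) : pathTo ρ n ≠ [] := by simp [pathTo]

theorem length_pathTo (ρ : ℕ → S) (n : ℕ) : (pathTo ρ n).length = n + 1 := by simp [pathTo]

theorem pathTo_take (ρ : ℕ → S) {m n : ℕ} (h : m ≤ n) :
    (pathTo ρ n).take (m + 1) = pathTo ρ m := by
  rw [pathTo, pathTo, ← List.map_take, List.take_range, min_eq_left (by omega)]

theorem pathTo_prefix (ρ : ℕ → S) {m n : ℕ} (h : m ≤ n) : pathTo ρ m <+: pathTo ρ n := by
  rw [← pathTo_take ρ h]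
  exact List.take_prefix _ _

/-- The path given by a history up to time `n`. The index is truncated by `min` only to make it an
element of `Finset.Iic n`. -/
def historyPath (n : ℕ) (h : (_ : Finset.Iic n) → S) : List S :=
  (List.range (n + 1)).map fun i => h ⟨min i n, Finset.mem_Iic.2 (min_le_right i n)⟩

theorem pathTo_eq_historyPath (ρ : ℕ → S) (n : ℕ) :
    pathTo ρ n = historyPath n (Preorder.frestrictLe n ρ) := by
  refine List.map_congr_left fun i hi => ?_
  rw [List.mem_range] at hi
  simp [min_eq_left (Nat.lt_succ_iff.1 hi)]

end PathGraph

namespace MarkovChain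

open PathGraph

variable {S : Type*} [Fintype S] [MeasurableSpace S] [DiscreteMeasurableSpace S]

theorem measurable_comp_pathTo {α : Type*} [MeasurableSpace α] (F : List S → α) (n : ℕ) :
    Measurable fun ρ : ℕ → S => F (pathTo ρ n) := by
  simp only [pathTo_eq_historyPath]
  exact (Measurable.of_discrete (f := fun h => F (historyPath n h))).comp
    (Preorder.measurable_frestrictLe n)

theorem measurableSet_pathTo (p : List S → Prop) (n : ℕ) :
    MeasurableSet {ρ : ℕ → S | p (pathTo ρ n)} :=
  measurableSet_setOfPred.2 (measurable_comp_pathTo p n)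

theorem integrable_comp_pathTo (ν : Measure (ℕ → S)) [IsFiniteMeasure ν] (F : List S → ℝ) (n : ℕ) :
    Integrable (fun ρ => F (pathTo ρ n)) ν := by
  simp only [pathTo_eq_historyPath]
  exact (Integrable.of_finite (f := fun h => F (historyPath n h))
    (μ := ν.map (Preorder.frestrictLe n))).comp_measurable (Preorder.measurable_frestrictLe n)

theorem integral_weightMeasure {w : S → ℝ} (hw : ∀ s, 0 ≤ w s) (f : S → ℝ) :
    ∫ s, f s ∂weightMeasure w = ∑ s, w s * f s := by
  rw [weightMeasure, integral_finsetSum_measure fun s _ =>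
    (integrable_dirac (by simp)).smul_measure ENNReal.ofReal_ne_top]
  refine Finset.sum_congr rfl fun s _ => ?_
  rw [integral_smul_measure, integral_dirac, ENNReal.toReal_ofReal (hw s), smul_eq_mul]

variable (M : MarkovChain S)

/-- The Markov property, for functions of the path. -/
theorem integral_pathTo_succ (F : List S → ℝ) (n : ℕ) :
    ∫ ρ, F (pathTo ρ (n + 1)) ∂M.runMeasure
      = ∫ ρ, ∑ t, M.P (ρ n) t * F (pathTo ρ n ++ [t]) ∂M.runMeasure := by
  let G : ((_ : Finset.Iic n) → S) × S → ℝ := fun q => F (historyPath n q.1 ++ [q.2])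
  have hmeas : Measurable fun ρ : ℕ → S => (Preorder.frestrictLe n ρ, ρ (n + 1)) :=
    (Preorder.measurable_frestrictLe n).prodMk (measurable_pi_apply _)
  have hG : Measurable G := Measurable.of_discrete
  have key := Kernel.map_frestrictLe_trajMeasure_compProd_eq_map_trajMeasure (X := fun _ => S)
    (μ₀ := M.initialMeasure) (κ := M.historyKernel) (a := n)
  calc ∫ ρ, F (pathTo ρ (n + 1)) ∂M.runMeasure
      = ∫ ρ, G (Preorder.frestrictLe n ρ, ρ (n + 1)) ∂M.runMeasure := by
        simp only [pathTo_succ, pathTo_eq_historyPath _ n, G]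
    _ = ∫ q, G q ∂(M.runMeasure.map fun ρ : ℕ → S => (Preorder.frestrictLe n ρ, ρ (n + 1))) :=
        (integral_map hmeas.aemeasurable hG.aestronglyMeasurable).symm
    _ = ∫ q, G q ∂(M.runMeasure.map (Preorder.frestrictLe n) ⊗ₘ M.historyKernel n) := by
        rw [runMeasure, ← key]
    _ = ∫ h, ∫ t, G (h, t) ∂M.historyKernel n h ∂(M.runMeasure.map (Preorder.frestrictLe n)) := by
        have : IsProbabilityMeasure (M.runMeasure.map (Preorder.frestrictLe (π := fun _ => S) n)) :=
          Measure.isProbabilityMeasure_map (Preorder.measurable_frestrictLe n).aemeasurable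
        exact Measure.integral_compProd Integrable.of_finite
    _ = ∫ ρ, ∫ t, G (Preorder.frestrictLe n ρ, t) ∂M.historyKernel n (Preorder.frestrictLe n ρ)
          ∂M.runMeasure :=
        integral_map (Preorder.measurable_frestrictLe n).aemeasurable
          Measurable.of_discrete.aestronglyMeasurable
    _ = _ := by
        refine integral_congr_ae (ae_of_all _ fun ρ => ?_)
        simp only [G, ← pathTo_eq_historyPath]
        exact integral_weightMeasure (M.P_nonneg (ρ n)) _

theorem integral_pathTo_zero (F : List S → ℝ) :
    ∫ ρ, F (pathTo ρ 0) ∂M.runMeasure = ∑ s, M.μ s * F [s] := by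
  have hmap : M.runMeasure.map (Preorder.frestrictLe (π := fun _ => S) 0)
      = M.initialMeasure.map (MeasurableEquiv.piUnique fun _ : Finset.Iic 0 => S).symm := by
    rw [runMeasure, Kernel.trajMeasure, Measure.map_comp _ _ (Preorder.measurable_frestrictLe 0),
      Kernel.traj_map_frestrictLe, Kernel.partialTraj_self, Measure.id_comp]
  calc ∫ ρ, F (pathTo ρ 0) ∂M.runMeasure
      = ∫ h, F (historyPath 0 h)
          ∂(M.runMeasure.map (Preorder.frestrictLe (π := fun _ => S) 0)) := by
        rw [integral_map (Preorder.measurable_frestrictLe 0).aemeasurable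
          Measurable.of_discrete.aestronglyMeasurable]
        simp only [pathTo_eq_historyPath]
    _ = ∫ s, F [s] ∂M.initialMeasure := by
        rw [hmap, integral_map (MeasurableEquiv.measurable _).aemeasurable
          Measurable.of_discrete.aestronglyMeasurable]
        rfl
    _ = _ := integral_weightMeasure M.μ_nonneg _

theorem integral_eval (f : S → ℝ) (n : ℕ) :
    ∫ ρ, f (ρ n) ∂M.runMeasure = ∑ s, M.μ s * (M.transition ^ n) f s := by
  induction n generalizing f with
  | zero => simpa [pathTo_zero] using M.integral_pathTo_zero fun π => (π.map f).headD 0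
  | succ n ih =>
    have h := M.integral_pathTo_succ (fun π => (π.map f).getLastD 0) n
    simp only [pathTo_succ, List.map_append, List.map_cons, List.map_nil,
      List.getLastD_concat] at h
    rw [h, pow_succ, Module.End.mul_apply]
    exact ih (M.transition f)

theorem integrable_eval (f : S → ℝ) (n : ℕ) : Integrable (fun ρ => f (ρ n)) M.runMeasure := by
  simpa [pathTo_eq_append] using
    integrable_comp_pathTo M.runMeasure (fun π => (π.map f).getLastD 0) n

theorem integral_average (r : S → ℝ) (n : ℕ) :
    ∫ ρ, (1 / (n : ℝ)) * ∑ i ∈ Finset.Icc 1 n, r (ρ i) ∂M.runMeasure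
      = ∑ s, M.μ s * M.timeAverage r n s := by
  rw [integral_const_mul, integral_finsetSum _ fun i _ => M.integrable_eval r i]
  simp only [integral_eval, timeAverage]
  rw [Finset.sum_comm, Finset.mul_sum]
  refine Finset.sum_congr rfl fun s _ => ?_
  rw [← Finset.mul_sum]
  ring

theorem tendsto_integral_average (r : S → ℝ) :
    Tendsto (fun n : ℕ => ∫ ρ, (1 / (n : ℝ)) * ∑ i ∈ Finset.Icc 1 n, r (ρ i) ∂M.runMeasure)
      atTop (𝓝 (∑ s, M.μ s * M.ergodicLimit r s)) := by
  simp only [integral_average]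
  exact tendsto_finsetSum _ fun s _ => (M.tendsto_ergodicLimit r s).const_mul _

theorem meanPayoff_eq (r : S → ℝ) : M.meanPayoff r = ∑ s, M.μ s * M.ergodicLimit r s :=
  (M.tendsto_integral_average r).limUnder_eq

theorem integral_ergodicLimit (r : S → ℝ) (n : ℕ) :
    ∫ ρ, M.ergodicLimit r (ρ n) ∂M.runMeasure = M.meanPayoff r := by
  rw [integral_eval, M.transition_pow_eq_self (M.transition_ergodicLimit r), meanPayoff_eq]

theorem meanPayoff_mem_Icc {r : S → ℝ} (hr : ∀ s, r s ∈ Set.Icc (0 : ℝ) 1) :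
    M.meanPayoff r ∈ Set.Icc (0 : ℝ) 1 := by
  rw [meanPayoff_eq]
  constructor
  · exact Finset.sum_nonneg fun s _ =>
      mul_nonneg (M.μ_nonneg s) (M.ergodicLimit_nonneg (fun s => (hr s).1) s)
  · calc ∑ s, M.μ s * M.ergodicLimit r s ≤ ∑ s, M.μ s * 1 := Finset.sum_le_sum fun s _ =>
          mul_le_mul_of_nonneg_left (M.ergodicLimit_le_one (fun s => (hr s).2) s) (M.μ_nonneg s)
      _ = 1 := by simp [M.μ_sum]

theorem ae_P_pos : ∀ᵐ ρ ∂M.runMeasure, ∀ n, 0 < M.P (ρ n) (ρ (n + 1)) := by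
  classical
  rw [ae_all_iff]
  intro n
  let F : List S → ℝ := fun π =>
    if ∃ π' s t, π = π' ++ [s] ++ [t] ∧ M.P s t = 0 then 1 else 0
  have hF : ∀ π s t, F (π ++ [s] ++ [t]) = if M.P s t = 0 then 1 else 0 := by
    intro π s t
    simp only [F]
    congr 1
    simp only [eq_iff_iff]
    constructor
    · rintro ⟨π', s', t', h, h0⟩
      obtain ⟨h1, h2⟩ := List.append_inj' h rfl
      obtain ⟨-, h3⟩ := List.append_inj' h1 rfl
      simp only [List.cons.injEq, and_true] at h2 h3
      rwa [h2, h3]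
    · exact fun h => ⟨π, s, t, rfl, h⟩
  have h := M.integral_pathTo_succ F n
  have h0 : ∀ ρ : ℕ → S, ∑ t, M.P (ρ n) t * F (pathTo ρ n ++ [t]) = 0 := fun ρ =>
    Finset.sum_eq_zero fun t _ => by
      rw [pathTo_eq_append, hF]
      split_ifs with h <;> simp [h]
  simp only [h0, integral_zero] at h
  have h1 := (integral_eq_zero_iff_of_nonneg (fun ρ => by
    simp only [F, Pi.zero_apply]; split_ifs <;> norm_num)
    (integrable_comp_pathTo M.runMeasure F (n + 1))).1 h
  filter_upwards [h1] with ρ hρ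
  rw [pathTo_succ, pathTo_eq_append, hF] at hρ
  refine (M.P_nonneg _ _).lt_of_ne fun h => ?_
  simp [h.symm] at hρ

/-! ### Ville's maximal inequality -/

variable {M}

theorem IsSuperharmonic.integral_pathTo_le {V : List S → ℝ} (hV : M.IsSuperharmonic V) (n : ℕ) :
    ∫ ρ, V (pathTo ρ n) ∂M.runMeasure ≤ ∑ s, M.μ s * V [s] := by
  induction n with
  | zero => rw [integral_pathTo_zero]
  | succ n ih =>
    refine le_trans ?_ ih
    rw [integral_pathTo_succ]
    refine integral_mono ?_ (integrable_comp_pathTo _ _ _) fun ρ => ?_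
    · have := integrable_comp_pathTo M.runMeasure
        (fun π => π.getLast?.elim 0 fun s => ∑ t, M.P s t * V (π ++ [t])) n
      simpa only [pathTo_eq_append, List.getLast?_concat, Option.elim_some] using this
    · simp only [pathTo_eq_append]
      exact hV.step _ _

/-- Ville's maximal inequality. -/
theorem IsSuperharmonic.measure_exists_le {V : List S → ℝ} (hV : M.IsSuperharmonic V) :
    M.runMeasure {ρ | ∃ n, 1 ≤ V (pathTo ρ n)} ≤ ENNReal.ofReal (∑ s, M.μ s * V [s]) := by
  classical
  -- `U` is the function `V` stopped at the value `1` when `V` first reaches `1`.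
  let U : List S → ℝ := fun π => if ∃ π', π' ≠ [] ∧ π' <+: π ∧ 1 ≤ V π' then 1 else V π
  have hUV : ∀ π t, (¬ ∃ π', π' ≠ [] ∧ π' <+: π ∧ 1 ≤ V π') → U (π ++ [t]) ≤ V (π ++ [t]) := by
    intro π t h
    simp only [U]
    split_ifs with h'
    · obtain ⟨π', h1, h2, h3⟩ := h'
      rcases List.prefix_concat_iff.1 h2 with rfl | h2
      · exact h3
      · exact absurd ⟨π', h1, h2, h3⟩ h
    · exact le_rfl
  have hU : M.IsSuperharmonic U := by
    refine ⟨fun π => ?_, fun π s => ?_⟩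
    · simp only [U]
      split_ifs
      exacts [zero_le_one, hV.nonneg π]
    · by_cases h : ∃ π', π' ≠ [] ∧ π' <+: π ++ [s] ∧ 1 ≤ V π'
      · have h1 : ∀ t, U (π ++ [s] ++ [t]) = 1 := fun t => by
          obtain ⟨π', h1, h2, h3⟩ := h
          exact if_pos ⟨π', h1, h2.trans (List.prefix_append _ _), h3⟩
        simp only [h1, mul_one, M.P_sum]
        exact (if_pos h).ge
      · calc ∑ t, M.P s t * U (π ++ [s] ++ [t])
            ≤ ∑ t, M.P s t * V (π ++ [s] ++ [t]) := Finset.sum_le_sum fun t _ =>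
              mul_le_mul_of_nonneg_left (hUV _ t h) (M.P_nonneg s t)
          _ ≤ V (π ++ [s]) := hV.step π s
          _ = U (π ++ [s]) := (if_neg h).symm
  let A : ℕ → Set (ℕ → S) := fun n => {ρ | 1 ≤ U (pathTo ρ n)}
  have hA : {ρ | ∃ n, 1 ≤ V (pathTo ρ n)} ⊆ ⋃ n, A n := by
    rintro ρ ⟨n, hn⟩
    exact Set.mem_iUnion.2 ⟨n, (if_pos ⟨_, pathTo_ne_nil ρ n, List.prefix_rfl, hn⟩ :
      U (pathTo ρ n) = 1).ge⟩
  have hmono : Monotone A := monotone_nat_of_le_succ fun n ρ hρ => by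
    have : ∃ π', π' ≠ [] ∧ π' <+: pathTo ρ n ∧ 1 ≤ V π' := by
      by_contra h
      have h1 : 1 ≤ U (pathTo ρ n) := hρ
      simp only [U, if_neg h] at h1
      exact h ⟨_, pathTo_ne_nil ρ n, List.prefix_rfl, h1⟩
    obtain ⟨π', h1, h2, h3⟩ := this
    exact (if_pos ⟨π', h1, h2.trans (pathTo_prefix ρ n.le_succ), h3⟩ :
      U (pathTo ρ (n + 1)) = 1).ge
  refine (measure_mono hA).trans ?_
  rw [hmono.measure_iUnion]
  refine iSup_le fun n => ?_
  have h1 : M.runMeasure.real (A n) ≤ ∑ s, M.μ s * V [s] := by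
    have h2 := mul_meas_ge_le_integral_of_nonneg (μ := M.runMeasure)
      (f := fun ρ => U (pathTo ρ n)) (ae_of_all _ fun ρ => hU.nonneg _)
      (integrable_comp_pathTo _ _ _) 1
    rw [one_mul] at h2
    refine h2.trans ((hU.integral_pathTo_le n).trans (Finset.sum_le_sum fun s _ =>
      mul_le_mul_of_nonneg_left ?_ (M.μ_nonneg s)))
    refine hUV [] s ?_
    rintro ⟨π', h1, h2, -⟩
    exact h1 (List.prefix_nil.1 h2)
  rw [← ENNReal.ofReal_toReal (measure_ne_top M.runMeasure (A n))]
  exact ENNReal.ofReal_le_ofReal h1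

end MarkovChain

/-! ### Candidates along a growing path -/

namespace PathGraph

section Graph

variable {S : Type*}

theorem mem_of_transGen {E : S → S → Prop} {C : Finset S}
    (hcl : ∀ s ∈ C, ∀ t, t ∉ C → ¬ E s t) {s t : S} (hs : s ∈ C) (h : Relation.TransGen E s t) :
    t ∈ C := by
  induction h with
  | single h => by_contra ht; exact hcl s hs _ ht h
  | tail _ h ih => by_contra ht; exact hcl _ ih _ ht h

/-- Maximality is automatic for a strongly connected set without outgoing edges. -/
theorem isBSCC_iff {E : S → S → Prop} {C : Finset S} :
    IsBSCC E C ↔ IsSC E C ∧ ∀ s ∈ C, ∀ t, t ∉ C → ¬ E s t := by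
  refine ⟨fun h => ⟨h.1, h.2.2⟩, fun h => ⟨h.1, fun D hD hCD => ?_, h.2⟩⟩
  obtain ⟨s, hs⟩ := h.1.1
  exact Finset.Subset.antisymm (fun t ht => mem_of_transGen h.2 hs (hD.2 s (hCD hs) t ht)) hCD

theorem edge_snoc {π : List S} {u v s t : S} :
    Edge (π ++ [u] ++ [v]) s t ↔ Edge (π ++ [u]) s t ∨ (s = u ∧ t = v) := by
  unfold Edge
  rw [List.infix_concat_iff, or_comm]
  refine or_congr_right ⟨?_, ?_⟩
  · rintro ⟨a, h⟩
    have h' : a ++ [s] ++ [t] = π ++ [u] ++ [v] := by simpa using h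
    obtain ⟨h1, h2⟩ := List.append_inj' h' rfl
    obtain ⟨-, h3⟩ := List.append_inj' h1 rfl
    simp only [List.cons.injEq, and_true] at h2 h3
    exact ⟨h3, h2⟩
  · rintro ⟨rfl, rfl⟩
    exact ⟨π, by simp⟩

theorem Edge.mono {π π' : List S} (h : π <:+: π') {s t : S} (he : Edge π s t) : Edge π' s t :=
  List.IsInfix.trans he h

theorem edge_append_cons (π σ : List S) (u v : S) : Edge (π ++ [u] ++ v :: σ) u v :=
  ⟨π, σ, by simp⟩

theorem not_edge_singleton (s u v : S) : ¬ Edge [s] u v := fun h => by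
  simpa using h.length_le

end Graph

variable {S : Type*} [DecidableEq S]

theorem candidate_eq_some {π : List S} {C : Finset S} :
    candidate π = some C ↔ IsCandidate π C := by
  unfold candidate
  split_ifs with h
  · rw [Option.some_inj]
    exact ⟨fun e => e ▸ h.choose_spec, fun hC => h.choose_spec.unique hC⟩
  · exact ⟨fun e => by simp at e, fun hC => absurd ⟨C, hC⟩ h⟩

theorem IsCandidate.exists_eq_snoc {π : List S} {C : Finset S} (h : IsCandidate π C) :
    ∃ π' u, π = π' ++ [u] ∧ u ∈ C := by
  obtain ⟨κ, ⟨a, rfl⟩, rfl, hκ⟩ := h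
  rcases κ.eq_nil_or_concat with rfl | ⟨κ', u, rfl⟩
  · simpa using hκ.1.1
  · exact ⟨a ++ κ', u, by simp, by simp⟩

theorem IsCandidate.snoc {π : List S} {C : Finset S} (h : IsCandidate π C) {t : S} (ht : t ∈ C) :
    IsCandidate (π ++ [t]) C := by
  obtain ⟨π', u, rfl, hu⟩ := h.exists_eq_snoc
  obtain ⟨κ, ⟨a, ha⟩, hκC, hκ⟩ := h
  refine ⟨κ ++ [t], ⟨a, by rw [← List.append_assoc, ha]⟩, ?_, isBSCC_iff.2 ⟨⟨hκ.1.1, ?_⟩, ?_⟩⟩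
  · rw [List.toFinset_append, hκC]
    simpa using ht
  · intro s hs s' hs'
    exact Relation.TransGen.mono (fun a b he => he.mono (List.prefix_append _ _).isInfix) _ _
      (hκ.1.2 s hs s' hs')
  · intro s hs v hv he
    rcases edge_snoc.1 he with he | ⟨-, rfl⟩
    · exact hκ.2.2 s hs v hv he
    · exact hv ht

theorem IsCandidate.append {π : List S} {C : Finset S} (h : IsCandidate π C) {σ : List S}
    (hσ : ∀ x ∈ σ, x ∈ C) : IsCandidate (π ++ σ) C := by
  induction σ generalizing π with
  | nil => simpa using h
  | cons x σ ih =>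
    have := ih (h.snoc (hσ x (by simp))) fun y hy => hσ y (by simp [hy])
    simpa using this

/-- Once a candidate is left, it never becomes a candidate again. -/
theorem IsCandidate.mem_of_append {π : List S} {C : Finset S} (h : IsCandidate π C) {σ : List S}
    (h' : IsCandidate (π ++ σ) C) : ∀ x ∈ σ, x ∈ C := by
  induction σ generalizing π with
  | nil => simp
  | cons x σ ih =>
    obtain ⟨π', u, rfl, hu⟩ := h.exists_eq_snoc
    have hx : x ∈ C := by
      by_contra hx
      obtain ⟨κ, -, -, hκ⟩ := h'
      exact hκ.2.2 u hu x hx (edge_append_cons π' σ u x)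
    have := ih (h.snoc hx) (by simpa using h')
    simpa [hx] using this

theorem IsCandidate.not_prefix {π : List S} {t : S} {C : Finset S} (h : IsCandidate (π ++ [t]) C)
    (hπ : ¬ IsCandidate π C) {π' : List S} (hp : π' <+: π) : ¬ IsCandidate π' C := by
  obtain ⟨σ, rfl⟩ := hp
  intro h'
  rw [List.append_assoc] at h
  exact hπ (h'.append fun x hx => h'.mem_of_append h x (by simp [hx]))

theorem candidate_singleton (s : S) : candidate [s] = none := by
  rw [Option.eq_none_iff_forall_not_mem]
  intro C hC
  obtain ⟨κ, -, -, hκ⟩ := candidate_eq_some.1 hC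
  obtain ⟨t, ht⟩ := hκ.1.1
  obtain ⟨v, hv, -⟩ := Relation.TransGen.head'_iff.1 (hκ.1.2 t ht t ht)
  exact not_edge_singleton s _ _ hv

/-- The state of the loop of `ReachedBSCC`: the latest candidate and its index. -/
noncomputable def loopState (π : List S) : Option (Finset S) × ℕ :=
  (List.range π.length).foldl (fun Ci j => loopStep Ci (π.take (j + 1))) (none, 0)

theorem loopState_snoc (π : List S) (t : S) :
    loopState (π ++ [t]) = loopStep (loopState π) (π ++ [t]) := by
  unfold loopState
  rw [List.length_append, List.length_singleton, List.range_succ, List.foldl_append,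
    List.foldl_cons, List.foldl_nil, List.take_of_length_le (by simp)]
  congr 1
  refine List.foldl_ext _ _ _ fun Ci j hj => ?_
  rw [List.mem_range] at hj
  rw [List.take_append_of_le_length (by omega)]

theorem loopState_fst_of_candidate {π : List S} {C : Finset S} (h : IsCandidate π C) :
    (loopState π).1 = some C := by
  obtain ⟨π', u, rfl, -⟩ := h.exists_eq_snoc
  rw [loopState_snoc, loopStep, candidate_eq_some.2 h]
  split_ifs with h'
  · rfl
  · by_contra hne
    exact h' ⟨by simp, fun e => hne e.symm⟩

theorem exists_prefix_of_loopState_fst {π : List S} {C : Finset S}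
    (h : (loopState π).1 = some C) : ∃ π', π' <+: π ∧ IsCandidate π' C := by
  induction π using List.reverseRecOn with
  | nil => simp [loopState] at h
  | append_singleton π t ih =>
    rw [loopState_snoc, loopStep] at h
    split_ifs at h with h'
    · exact ⟨_, List.prefix_rfl, candidate_eq_some.1 h⟩
    · obtain ⟨π', h1, h2⟩ := ih h
      exact ⟨π', h1.trans (List.prefix_append _ _), h2⟩

theorem candidateIndex_pos {π : List S} {C : Finset S} (h : (loopState π).1 = some C) :
    1 ≤ candidateIndex π := by
  change 1 ≤ (loopState π).2
  induction π using List.reverseRecOn with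
  | nil => simp [loopState] at h
  | append_singleton π t ih =>
    rw [loopState_snoc, loopStep] at h ⊢
    split_ifs at h ⊢ with h'
    · simp
    · exact ih h

theorem candidateIndex_of_new {π : List S} {t : S} {C : Finset S}
    (h : IsCandidate (π ++ [t]) C) (hπ : ¬ IsCandidate π C) :
    candidateIndex (π ++ [t]) = candidateIndex π + 1 := by
  change (loopState _).2 = (loopState _).2 + 1
  rw [loopState_snoc, loopStep, if_pos]
  rw [candidate_eq_some.2 h]
  refine ⟨by simp, fun e => ?_⟩
  obtain ⟨π', h1, h2⟩ := exists_prefix_of_loopState_fst e.symm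
  exact h.not_prefix hπ h1 h2

theorem candidateIndex_of_candidate {π : List S} {t : S} {C : Finset S} (h : IsCandidate π C)
    (ht : t ∈ C) : candidateIndex (π ++ [t]) = candidateIndex π := by
  change (loopState _).2 = (loopState _).2
  rw [loopState_snoc, loopStep, if_neg]
  rw [candidate_eq_some.2 (h.snoc ht), loopState_fst_of_candidate h]
  simp

theorem candidateIndex_of_none {π : List S} {t : S} (h : candidate (π ++ [t]) = none) :
    candidateIndex (π ++ [t]) = candidateIndex π := by
  change (loopState _).2 = (loopState _).2
  rw [loopState_snoc, loopStep, if_neg]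
  simp [h]

theorem candidateIndex_singleton (s : S) : candidateIndex [s] = 0 :=
  (candidateIndex_of_none (π := []) (candidate_singleton s)).trans (by simp [candidateIndex])

/-! ### Departures from a state -/

/-- The number of occurrences of `s` on `π` that are followed by a further state. -/
def departures (π : List S) (s : S) : ℕ := π.dropLast.count s

theorem departures_snoc (π : List S) (u v s : S) :
    departures (π ++ [u] ++ [v]) s = departures (π ++ [u]) s + if s = u then 1 else 0 := by
  simp only [departures, List.dropLast_concat, List.count_append, List.count_singleton, beq_iff_eq,
    eq_comm (a := s)]

theorem transCount_snoc (π : List S) (u v s t : S) :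
    transCount (π ++ [u] ++ [v]) s t
      = transCount (π ++ [u]) s t + if s = u ∧ t = v then 1 else 0 := by
  have h1 : (π ++ [u] ++ [v]).zip (π ++ [u] ++ [v]).tail
      = π.zip (π ++ [u]).tail ++ [(u, v)] := by
    rw [List.tail_append_of_ne_nil (by simp), List.append_assoc, List.zip_append (by simp)]
    simp
  have h2 : (π ++ [u]).zip (π ++ [u]).tail = π.zip (π ++ [u]).tail := by
    have := List.zip_append (l₁ := π) (r₁ := [u]) (l₂ := (π ++ [u]).tail) (r₂ := []) (by simp)
    simpa using this
  simp only [transCount, h1, h2, List.count_append, List.count_singleton, beq_iff_eq,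
    Prod.mk.injEq, eq_comm (a := s), eq_comm (a := t)]

theorem transCount_singleton (u s t : S) : transCount [u] s t = 0 := by simp [transCount]

theorem departures_singleton (u s : S) : departures [u] s = 0 := by simp [departures]

theorem edge_of_transCount_pos {π : List S} {s t : S} (h : 0 < transCount π s t) :
    Edge π s t := by
  induction π using List.reverseRecOn with
  | nil => simp [transCount] at h
  | append_singleton π v ih =>
    rcases π.eq_nil_or_concat with rfl | ⟨π, u, rfl⟩
    · simp [transCount] at h
    · rw [List.concat_eq_append] at *
      rw [transCount_snoc] at h
      rw [edge_snoc]
      split_ifs at h with h'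
      · exact Or.inr h'
      · exact Or.inl (ih h)

theorem sum_transCount [Fintype S] (π : List S) (s : S) :
    ∑ u, transCount π s u = departures π s := by
  induction π using List.reverseRecOn with
  | nil => simp [transCount, departures]
  | append_singleton π v ih =>
    rcases π.eq_nil_or_concat with rfl | ⟨π, u, rfl⟩
    · simp [transCount, departures]
    · rw [List.concat_eq_append] at *
      simp only [transCount_snoc, departures_snoc, Finset.sum_add_distrib, ih]
      by_cases h : s = u <;> simp [h]

theorem departures_append_le {σ : List S} (hσ : σ ≠ []) (π : List S) (s : S) :
    departures σ s ≤ departures (π ++ σ) s := by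
  rw [departures, departures, List.dropLast_append_of_ne_nil hσ, List.count_append]
  omega

/-- The count of the last state is one higher in the definition of a `k`-candidate because its last
occurrence is not followed by a further state. -/
theorem IsKCandidate.le_departures {k : ℝ} {C : Finset S} {π : List S} (h : IsKCandidate k C π)
    {s : S} (hs : s ∈ C) : k ≤ departures π s := by
  obtain ⟨κ, ⟨a, rfl⟩, rfl, hκ, h1, h2⟩ := h
  rcases κ.eq_nil_or_concat with rfl | ⟨κ, u, rfl⟩
  · simp at hs
  · rw [List.concat_eq_append] at *
    have h3 : k ≤ departures (κ ++ [u]) s := by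
      rw [departures, List.dropLast_concat]
      by_cases hsu : s = u
      · have := h2 s (by simp [hsu])
        simp only [List.count_append, hsu, List.count_singleton_self] at this ⊢
        push_cast at this
        linarith
      · have := h1 s hs
        rwa [List.count_append, List.count_singleton, if_neg (by simpa using Ne.symm hsu),
          add_zero] at this
    exact h3.trans (by exact_mod_cast departures_append_le (by simp) a s)

theorem IsStrongKCandidate.le_departures {k : ℝ} {C : Finset S} {π : List S}
    (h : IsStrongKCandidate k C π) {s : S} (hs : s ∈ C) : k ≤ departures π s := by
  obtain ⟨α, β, γ, b, rfl, -, -, -, -, hk⟩ := h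
  exact (hk.le_departures hs).trans (by exact_mod_cast departures_append_le (by simp) (α ++ β) s)

end PathGraph

/-! ### False candidates -/

namespace PathGraph

variable {S : Type*} [DecidableEq S]

open Classical in
/-- The number of departures from `s` on `π` at times at which `C` is the candidate. -/
noncomputable def heldDepartures (π : List S) (C : Finset S) (s : S) : ℕ :=
  ∑ j ∈ Finset.range (π.length - 1),
    if IsCandidate (π.take (j + 1)) C ∧ π[j]? = some s then 1 else 0

open Classical in
theorem heldDepartures_snoc (π : List S) (u v : S) (C : Finset S) (s : S) :
    heldDepartures (π ++ [u] ++ [v]) C s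
      = heldDepartures (π ++ [u]) C s + if IsCandidate (π ++ [u]) C ∧ u = s then 1 else 0 := by
  unfold heldDepartures
  have h1 : (π ++ [u] ++ [v]).length - 1 = π.length + 1 := by simp
  have h2 : (π ++ [u]).length - 1 = π.length := by simp
  rw [h1, h2, Finset.sum_range_succ]
  congr 1
  · refine Finset.sum_congr rfl fun j hj => ?_
    rw [Finset.mem_range] at hj
    rw [List.take_append_of_le_length (l₁ := π ++ [u]) (by simp; omega),
      List.getElem?_append_left (l₁ := π ++ [u]) (by simp; omega)]
  · rw [List.take_append_of_le_length (l₁ := π ++ [u]) (by simp),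
      List.take_of_length_le (by simp), List.getElem?_append_left (l₁ := π ++ [u]) (by simp)]
    simp

theorem heldDepartures_of_new {π : List S} {v : S} {C : Finset S}
    (h : IsCandidate (π ++ [v]) C) (hπ : ¬ IsCandidate π C) (s : S) :
    heldDepartures (π ++ [v]) C s = 0 := by
  unfold heldDepartures
  refine Finset.sum_eq_zero fun j hj => if_neg fun hc => h.not_prefix hπ ?_ hc.1
  rw [Finset.mem_range, List.length_append, List.length_singleton] at hj
  rw [List.take_append_of_le_length (by omega)]
  exact List.take_prefix _ _

theorem departures_le_heldDepartures {π γ : List S} {b : S} {C : Finset S}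
    (h : IsCandidate (π ++ [b]) C) (hγ : ∀ x ∈ γ, x ∈ C) (s : S) :
    departures (b :: γ) s ≤ heldDepartures (π ++ b :: γ) C s := by
  induction γ using List.reverseRecOn with
  | nil => rw [departures_singleton]; exact Nat.zero_le _
  | append_singleton γ v ih =>
    have hγ' : ∀ x ∈ γ, x ∈ C := fun x hx => hγ x (by simp [hx])
    have hc : IsCandidate (π ++ b :: γ) C := by simpa using h.append hγ'
    have ih := ih hγ'
    rw [← List.cons_append]
    rcases (b :: γ).eq_nil_or_concat with hnil | ⟨τ, u, hτ⟩
    · simp at hnil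
    rw [List.concat_eq_append] at hτ
    rw [hτ] at ih hc ⊢
    rw [← List.append_assoc] at ih hc
    rw [← List.append_assoc, ← List.append_assoc, departures_snoc, heldDepartures_snoc]
    gcongr ?_ + ?_
    simp only [hc, true_and, eq_comm (a := s)]
    exact le_rfl

theorem IsStrongKCandidate.le_heldDepartures {k : ℝ} {C : Finset S} {π : List S}
    (h : IsStrongKCandidate k C π) {s : S} (hs : s ∈ C) : k ≤ heldDepartures π C s := by
  obtain ⟨α, β, γ, b, rfl, -, hC, -, hb, hk⟩ := h
  refine (hk.le_departures hs).trans ?_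
  exact_mod_cast departures_le_heldDepartures (candidate_eq_some.1 hb)
    (fun x hx => by rw [← hC]; simp [hx]) s

theorem one_le_of_bsccThreshold_le {p η : ℝ} (hp : 0 < p) (hp1 : p < 1) (hη : 0 < η) {i N : ℕ}
    (h : bsccThreshold p η i ≤ N) : 1 ≤ η * (1 / 2) ^ i * ((1 - p)⁻¹) ^ N := by
  have hq : 0 < 1 - p := by linarith
  have hlog2 : 0 < Real.log 2 := Real.log_pos one_lt_two
  have hlog : Real.log (1 - p) < 0 := Real.log_neg hq (by linarith)
  have hpos : 0 < -Real.logb 2 (1 - p) := by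
    rw [Real.logb, neg_pos]
    exact div_neg_of_neg_of_pos hlog hlog2
  rw [bsccThreshold, if_neg hp1.ne, div_le_iff₀ hpos] at h
  have h1 := mul_le_mul_of_nonneg_right h hlog2.le
  simp only [Real.logb] at h1
  rw [sub_mul, div_mul_cancel₀ _ hlog2.ne', mul_assoc, neg_mul, div_mul_cancel₀ _ hlog2.ne'] at h1
  rw [← Real.log_nonneg_iff (by positivity), Real.log_mul (by positivity) (by positivity),
    Real.log_mul (by positivity) (by positivity), Real.log_pow, Real.log_pow, Real.log_inv,
    one_div, Real.log_inv]
  linarith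

end PathGraph

namespace MarkovChain

open PathGraph

variable {S : Type*} [Fintype S] (M : MarkovChain S)

theorem le_P_of_le_pMin {p : ℝ} (hp : p ≤ M.pMin) {s t : S} (h : 0 < M.P s t) : p ≤ M.P s t :=
  hp.trans (csInf_le ⟨0, fun _ hx => hx.1.le⟩ ⟨h, s, t, rfl⟩)

theorem P_add_P_le_one {s t u : S} (h : t ≠ u) : M.P s t + M.P s u ≤ 1 := by
  classical
  rw [← M.P_sum s, ← Finset.sum_pair h]
  exact Finset.sum_le_univ_sum_of_nonneg (M.P_nonneg s)

variable [DecidableEq S]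

open Classical in
/-- The evidence against the current candidate `C` if the chain can leave `C`, where `e C` stands
for a state with a transition out of `C` of probability at least `p`: the inverse of an upper bound
for the probability that the departures from `e C` seen while `C` was the candidate all stayed
in `C`. It is `0` without a candidate or for a closed one. -/
noncomputable def evidence (p : ℝ) (e : Finset S → S) (π : List S) : ℝ :=
  (candidate π).elim 0 fun C =>
    if M.IsClosedSet C then 0 else ((1 - p)⁻¹) ^ heldDepartures π C (e C)

/-- The evidence against the current candidate, weighted by the error probability `η / 2 ^ i`
granted to the `i`-th candidate, plus the error probability granted to all later candidates. -/
noncomputable def falsePotential (p η : ℝ) (e : Finset S → S) (π : List S) : ℝ :=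
  η * (1 / 2) ^ candidateIndex π * (1 + M.evidence p e π)

variable {M} {p η : ℝ} {e : Finset S → S}

theorem evidence_of_none {π : List S} (h : candidate π = none) : M.evidence p e π = 0 := by
  rw [evidence, h, Option.elim_none]

theorem evidence_of_closed {π : List S} {C : Finset S} (h : IsCandidate π C)
    (hC : M.IsClosedSet C) : M.evidence p e π = 0 := by
  rw [evidence, candidate_eq_some.2 h, Option.elim_some, if_pos hC]

theorem evidence_of_not_closed {π : List S} {C : Finset S} (h : IsCandidate π C)
    (hC : ¬ M.IsClosedSet C) :
    M.evidence p e π = ((1 - p)⁻¹) ^ heldDepartures π C (e C) := by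
  rw [evidence, candidate_eq_some.2 h, Option.elim_some, if_neg hC]

theorem evidence_nonneg (hp1 : p < 1) (π : List S) : 0 ≤ M.evidence p e π := by
  have hq : 0 < 1 - p := by linarith
  rcases hc : candidate π with _ | C
  · rw [evidence_of_none hc]
  · by_cases hC : M.IsClosedSet C
    · rw [evidence_of_closed (candidate_eq_some.1 hc) hC]
    · rw [evidence_of_not_closed (candidate_eq_some.1 hc) hC]
      positivity

/-- A step that does not prolong the current candidate uses up the evidence: a new candidate starts
with evidence `1` and with half of the weight. -/
theorem falsePotential_snoc_le_of_new (hη : 0 ≤ η) {π : List S} {t : S}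
    (h : ∀ C, IsCandidate π C → t ∉ C) :
    M.falsePotential p η e (π ++ [t]) ≤ η * (1 / 2) ^ candidateIndex π := by
  unfold falsePotential
  rcases hc : candidate (π ++ [t]) with _ | C
  · rw [evidence_of_none hc, candidateIndex_of_none hc, add_zero, mul_one]
  · have hC := candidate_eq_some.1 hc
    obtain ⟨π', u, hu, huC⟩ := hC.exists_eq_snoc
    obtain ⟨-, htu⟩ := List.append_inj' hu rfl
    simp only [List.cons.injEq, and_true] at htu
    have hnew : ¬ IsCandidate π C := fun hπ => h C hπ (htu ▸ huC)
    have hev : M.evidence p e (π ++ [t]) ≤ 1 := by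
      by_cases hcl : M.IsClosedSet C
      · rw [evidence_of_closed hC hcl]; exact zero_le_one
      · rw [evidence_of_not_closed hC hcl, heldDepartures_of_new hC hnew, pow_zero]
    rw [candidateIndex_of_new hC hnew, pow_succ]
    calc η * ((1 / 2) ^ candidateIndex π * (1 / 2)) * (1 + M.evidence p e (π ++ [t]))
        ≤ η * ((1 / 2) ^ candidateIndex π * (1 / 2)) * (1 + 1) := by gcongr
      _ = _ := by ring

theorem isSuperharmonic_falsePotential (hp1 : p < 1) (hη : 0 ≤ η)
    (he : ∀ C, ¬ M.IsClosedSet C → ∃ t, t ∉ C ∧ p ≤ M.P (e C) t) :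
    M.IsSuperharmonic (M.falsePotential p η e) := by
  have hq : 0 < 1 - p := by linarith
  refine ⟨fun π => ?_, fun π u => ?_⟩
  · have := evidence_nonneg (M := M) (e := e) hp1 π
    unfold falsePotential
    positivity
  set c := η * (1 / 2) ^ candidateIndex (π ++ [u]) with hc
  have hc0 : 0 ≤ c := by positivity
  by_cases hfalse : ∃ C, IsCandidate (π ++ [u]) C ∧ ¬ M.IsClosedSet C
  · obtain ⟨C, hC, hcl⟩ := hfalse
    set w := M.evidence p e (π ++ [u]) with hw
    have hw0 : 0 ≤ w := evidence_nonneg hp1 _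
    let f : ℝ := if u = e C then (1 - p)⁻¹ else 1
    have hle : ∀ t, M.falsePotential p η e (π ++ [u] ++ [t])
        ≤ c * (1 + w * f * if t ∈ C then 1 else 0) := by
      intro t
      split_ifs with ht
      · refine le_of_eq ?_
        rw [falsePotential, candidateIndex_of_candidate hC ht,
          evidence_of_not_closed (hC.snoc ht) hcl, heldDepartures_snoc, pow_add,
          ← evidence_of_not_closed hC hcl, ← hw, ← hc, mul_one]
        simp only [hC, true_and, f]
        split_ifs <;> simp
      · rw [mul_zero, add_zero, mul_one]
        exact falsePotential_snoc_le_of_new hη fun D hD => hD.unique hC ▸ ht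
    have hstay : f * ∑ t, M.P u t * (if t ∈ C then 1 else 0) ≤ 1 := by
      have h1 : ∑ t, M.P u t * (if t ∈ C then (1 : ℝ) else 0) ≤ ∑ t, M.P u t :=
        Finset.sum_le_sum fun t _ => by
          split_ifs
          · rw [mul_one]
          · rw [mul_zero]; exact M.P_nonneg u t
      simp only [f]
      split_ifs with hu
      · obtain ⟨t₀, ht₀, hpt⟩ := he C hcl
        rw [inv_mul_le_iff₀ hq, mul_one, hu]
        have h2 : ∑ t, M.P (e C) t * (if t ∈ C then (1 : ℝ) else 0) + M.P (e C) t₀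
            ≤ ∑ t, M.P (e C) t := by
          rw [← Finset.add_sum_erase _ _ (Finset.mem_univ t₀),
            ← Finset.add_sum_erase (a := t₀) _ (fun t => M.P (e C) t) (Finset.mem_univ t₀),
            if_neg ht₀, mul_zero, zero_add, add_comm]
          gcongr with t _
          split_ifs
          · rw [mul_one]
          · rw [mul_zero]; exact M.P_nonneg _ t
        linarith [M.P_sum (e C)]
      · rw [one_mul]
        exact h1.trans (M.P_sum u).le
    calc ∑ t, M.P u t * M.falsePotential p η e (π ++ [u] ++ [t])
        ≤ ∑ t, M.P u t * (c * (1 + w * f * if t ∈ C then 1 else 0)) :=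
          Finset.sum_le_sum fun t _ => mul_le_mul_of_nonneg_left (hle t) (M.P_nonneg u t)
      _ = c * (∑ t, M.P u t + w * (f * ∑ t, M.P u t * (if t ∈ C then 1 else 0))) := by
          simp only [Finset.mul_sum, ← Finset.sum_add_distrib]
          exact Finset.sum_congr rfl fun t _ => by ring
      _ ≤ c * (1 + w * 1) := by
          rw [M.P_sum]
          gcongr
      _ = M.falsePotential p η e (π ++ [u]) := by rw [mul_one]; rfl
  · have hle : ∀ t, M.falsePotential p η e (π ++ [u] ++ [t]) ≤ c := by
      intro t
      by_cases hex : ∃ C, IsCandidate (π ++ [u]) C ∧ t ∈ C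
      · obtain ⟨C, hC, ht⟩ := hex
        have hcl : M.IsClosedSet C := by
          by_contra h
          exact hfalse ⟨C, hC, h⟩
        rw [falsePotential, candidateIndex_of_candidate hC ht, evidence_of_closed (hC.snoc ht) hcl,
          add_zero, mul_one]
      · exact falsePotential_snoc_le_of_new hη fun C hC ht => hex ⟨C, hC, ht⟩
    calc ∑ t, M.P u t * M.falsePotential p η e (π ++ [u] ++ [t])
        ≤ ∑ t, M.P u t * c :=
          Finset.sum_le_sum fun t _ => mul_le_mul_of_nonneg_left (hle t) (M.P_nonneg u t)
      _ = c := by rw [← Finset.sum_mul, M.P_sum, one_mul]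
      _ ≤ M.falsePotential p η e (π ++ [u]) := by
          have := mul_nonneg hc0 (evidence_nonneg (M := M) (e := e) hp1 (π ++ [u]))
          rw [falsePotential, ← hc]
          linarith

variable (M) in
/-- All transitions on `π` have positive probability. -/
def IsPath (π : List S) : Prop := ∀ s t, Edge π s t → 0 < M.P s t

/-- The error probability of `ReachedBSCC` is controlled by a superharmonic function that starts
below `η` and is at least `1` when the algorithm accepts a candidate that the chain can leave. -/
theorem exists_isSuperharmonic_of_false_answer (hp : 0 < p) (hpM : p ≤ M.pMin) (hη : 0 < η) :
    ∃ V : List S → ℝ, M.IsSuperharmonic V ∧ ∑ s, M.μ s * V [s] ≤ η ∧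
      ∀ π C, M.IsPath π → ReachedBSCC π p η → IsCandidate π C → ¬ M.IsClosedSet C → 1 ≤ V π := by
  have hexit : ∀ C, ∃ s, ¬ M.IsClosedSet C → s ∈ C ∧ ∃ t, t ∉ C ∧ p ≤ M.P s t := by
    intro C
    by_cases hC : M.IsClosedSet C
    · obtain ⟨s, -, -⟩ : ∃ s ∈ Finset.univ, M.μ s ≠ 0 :=
        Finset.exists_ne_zero_of_sum_ne_zero (by rw [M.μ_sum]; exact one_ne_zero)
      exact ⟨s, fun h => absurd hC h⟩
    · have hC' := hC
      simp only [IsClosedSet, not_forall] at hC'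
      obtain ⟨s, hs, t, ht, h⟩ := hC'
      exact ⟨s, fun _ => ⟨hs, t, ht, M.le_P_of_le_pMin hpM ((M.P_nonneg s t).lt_of_ne' h)⟩⟩
  choose e he using hexit
  by_cases hp1 : p < 1
  · refine ⟨M.falsePotential p η e,
      isSuperharmonic_falsePotential hp1 hη.le fun C hC => (he C hC).2, ?_, ?_⟩
    · simp only [falsePotential, candidateIndex_singleton, evidence_of_none (candidate_singleton _),
        pow_zero, mul_one, add_zero, ← Finset.sum_mul, M.μ_sum, one_mul, le_refl]
    · intro π C _ hyes hC hcl
      obtain ⟨-, K, hK, hstrong⟩ := hyes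
      obtain rfl := hC.unique (candidate_eq_some.1 hK)
      have h1 := one_le_of_bsccThreshold_le hp hp1 hη (hstrong.le_heldDepartures (he C hcl).1)
      rw [falsePotential, evidence_of_not_closed hC hcl, mul_add]
      have : 0 ≤ η * (1 / 2) ^ candidateIndex π * 1 := by positivity
      linarith
  · -- For `p = 1` the chain is deterministic, and an observed edge inside the candidate excludes
    -- an edge that leaves it.
    refine ⟨fun _ => 0, ⟨fun _ => le_rfl, fun _ _ => by simp⟩, by simpa using hη.le, ?_⟩
    intro π C hπ _ hC hcl
    obtain ⟨hs, t, ht, hpt⟩ := he C hcl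
    obtain ⟨κ, -, -, hκ⟩ := hC
    obtain ⟨v, hv, -⟩ := Relation.TransGen.head'_iff.1 (hκ.1.2 _ hs _ hs)
    have hvC : v ∈ C := by
      by_contra h
      exact hκ.2.2 _ hs v h hv
    have h1 := M.P_add_P_le_one (s := e C) (t := t) (u := v) fun h => ht (h ▸ hvC)
    have h2 := hπ _ _ hv
    linarith [not_lt.1 hp1]

end MarkovChain

/-! ### Errors of the estimated transition probabilities -/

namespace PathGraph

theorem transPrecision_pos {p ε : ℝ} (hp : 0 < p) (hε : 0 < ε) {S : Type*}
    {K : Finset S} (hK : K.Nonempty) :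
    0 < transPrecision p ε K := by
  have hcard : (0 : ℝ) < K.card := by exact_mod_cast hK.card_pos
  exact mul_pos hp (sub_pos.2 (Real.one_lt_rpow (by linarith) (by positivity)))

end PathGraph

namespace MarkovChain

open PathGraph

variable {S : Type*} [Fintype S] {M : MarkovChain S}

/-- A bottom strongly connected component of the chain: a closed set of states in which any state is
reached from any other one. -/
structure IsBottom (M : MarkovChain S) (K : Finset S) : Prop where
  nonempty : K.Nonempty
  closed : M.IsClosedSet K
  irreducible : M.IsIrreducibleOn K

theorem IsClosedSet.mem_of_reflTransGen {K : Finset S} (hK : M.IsClosedSet K) {s t : S}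
    (hs : s ∈ K) (h : Relation.ReflTransGen (fun s t => 0 < M.P s t) s t) : t ∈ K := by
  induction h with
  | refl => exact hs
  | @tail b c _ hbc ih =>
    by_contra hc
    rw [hK b ih c hc] at hbc
    exact lt_irrefl _ hbc

theorem IsBottom.eq_of_mem {K L : Finset S} (hK : M.IsBottom K) (hL : M.IsBottom L) {s : S}
    (hsK : s ∈ K) (hsL : s ∈ L) : K = L :=
  Finset.Subset.antisymm
    (fun t ht => hL.closed.mem_of_reflTransGen hsL (hK.irreducible s hsK t ht))
    (fun t ht => hK.closed.mem_of_reflTransGen hsK (hL.irreducible s hsL t ht))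

variable [DecidableEq S]

variable (M) in
/-- The long-run frequency of visits to `K`, as a function of the initial state. For a closed set
it is a harmonic function that is `1` on `K`. -/
noncomputable def absorption (K : Finset S) : S → ℝ :=
  M.ergodicLimit fun s => if s ∈ K then 1 else 0

theorem absorption_nonneg (K : Finset S) (s : S) : 0 ≤ M.absorption K s :=
  M.ergodicLimit_nonneg (fun s => by split_ifs <;> norm_num) s

theorem absorption_le_one (K : Finset S) (s : S) : M.absorption K s ≤ 1 :=
  M.ergodicLimit_le_one (fun s => by split_ifs <;> norm_num) s

theorem sum_P_mul_absorption (K : Finset S) (s : S) :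
    ∑ t, M.P s t * M.absorption K t = M.absorption K s :=
  congrFun (M.transition_ergodicLimit _) s

theorem IsClosedSet.absorption_eq_one {K : Finset S} (hK : M.IsClosedSet K) {s : S} (hs : s ∈ K) :
    M.absorption K s = 1 := by
  rw [absorption, hK.ergodicLimit_congr (g := fun _ => 1) (fun t ht => if_pos ht) hs,
    ergodicLimit_const]

theorem sum_absorption_le_one {A : Finset (Finset S)} (hA : ∀ K ∈ A, M.IsBottom K) (s : S) :
    ∑ K ∈ A, M.absorption K s ≤ 1 := by
  have h := M.ergodicLimit_sum A (fun _ => 1) (fun K t => if t ∈ K then 1 else 0) s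
  simp only [one_mul] at h
  unfold absorption
  rw [← h]
  refine M.ergodicLimit_le_one (fun t => ?_) s
  rw [Finset.sum_boole]
  have : (A.filter fun K => t ∈ K).card ≤ 1 := Finset.card_le_one.2 fun K hK L hL => by
    rw [Finset.mem_filter] at hK hL
    exact (hA K hK.1).eq_of_mem (hA L hL.1) hK.2 hL.2
  exact_mod_cast this

/-- Hoeffding's lemma for the indicator of one transition. -/
theorem sum_P_mul_exp_le (M : MarkovChain S) (s t : S) (l : ℝ) :
    ∑ v, M.P s v * Real.exp (l * ((if t = v then 1 else 0) - M.P s t)) ≤ Real.exp (l ^ 2 / 8) := by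
  let _ : MeasurableSpace S := ⊤
  have : IsProbabilityMeasure (weightMeasure (M.P s)) :=
    isProbabilityMeasure_weightMeasure (M.P_nonneg s) (M.P_sum s)
  let X : S → ℝ := fun v => if t = v then 1 else 0
  have h := (hasSubgaussianMGF_of_mem_Icc (μ := weightMeasure (M.P s)) (X := X) (a := 0) (b := 1)
    Measurable.of_discrete.aemeasurable
    (ae_of_all _ fun v => by simp only [X]; split_ifs <;> simp)).mgf_le l
  have hX : ∫ v, X v ∂weightMeasure (M.P s) = M.P s t := by
    rw [integral_weightMeasure (M.P_nonneg s)]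
    simp [X]
  rw [mgf, hX, integral_weightMeasure (M.P_nonneg s)] at h
  refine h.trans (le_of_eq ?_)
  congr 1
  simp
  ring

variable (M) in
/-- The exponential supermartingale for the deviation of the number of transitions from `s` to `t`
from its compensator, with parameter `l`. -/
noncomputable def expDeviation (l : ℝ) (s t : S) (π : List S) : ℝ :=
  Real.exp (l * (transCount π s t - departures π s * M.P s t) - departures π s * (l ^ 2 / 8))

variable (M) in
/-- The exponential supermartingale for a transition in `K`, multiplied by the probability that the
chain is absorbed in `K`. The latter makes the initial values of all bottom components add up. -/
noncomputable def deviationPotential (K : Finset S) (l : ℝ) (s t : S) (π : List S) : ℝ :=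
  (π.getLast?.elim 0 (M.absorption K)) * M.expDeviation l s t π

theorem deviationPotential_snoc (K : Finset S) (l : ℝ) (s t : S) (π : List S) (u : S) :
    M.deviationPotential K l s t (π ++ [u])
      = M.absorption K u * M.expDeviation l s t (π ++ [u]) := by
  rw [deviationPotential, List.getLast?_concat, Option.elim_some]

theorem isSuperharmonic_deviationPotential {K : Finset S} (hK : M.IsClosedSet K) (l : ℝ) {s : S}
    (hs : s ∈ K) (t : S) : M.IsSuperharmonic (M.deviationPotential K l s t) := by
  refine ⟨fun π => ?_, fun π u => ?_⟩
  · refine mul_nonneg ?_ (Real.exp_pos _).le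
    cases π.getLast? with
    | none => exact le_rfl
    | some u => exact absorption_nonneg K u
  · simp only [deviationPotential_snoc]
    set E := M.expDeviation l s t (π ++ [u]) with hE
    have hE0 : 0 ≤ E := (Real.exp_pos _).le
    rcases eq_or_ne s u with rfl | hu
    · have hstep : ∀ v, M.expDeviation l s t (π ++ [s] ++ [v])
          = E * Real.exp (-(l ^ 2 / 8)) * Real.exp (l * ((if t = v then 1 else 0) - M.P s t)) := by
        intro v
        rw [hE, expDeviation, expDeviation, ← Real.exp_add, ← Real.exp_add, departures_snoc,
          transCount_snoc]
        congr 1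
        simp only [true_and, if_true]
        push_cast
        ring
      calc ∑ v, M.P s v * (M.absorption K v * M.expDeviation l s t (π ++ [s] ++ [v]))
          ≤ ∑ v, M.P s v * (1 * M.expDeviation l s t (π ++ [s] ++ [v])) := by
            refine Finset.sum_le_sum fun v _ => mul_le_mul_of_nonneg_left ?_ (M.P_nonneg s v)
            exact mul_le_mul_of_nonneg_right (absorption_le_one K v) (Real.exp_pos _).le
        _ = E * Real.exp (-(l ^ 2 / 8)) *
              ∑ v, M.P s v * Real.exp (l * ((if t = v then 1 else 0) - M.P s t)) := by
            rw [Finset.mul_sum]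
            refine Finset.sum_congr rfl fun v _ => ?_
            rw [hstep]
            ring
        _ ≤ E * Real.exp (-(l ^ 2 / 8)) * Real.exp (l ^ 2 / 8) := by
            gcongr
            exact M.sum_P_mul_exp_le s t l
        _ = M.absorption K s * E := by
            rw [mul_assoc, ← Real.exp_add, neg_add_cancel, Real.exp_zero,
              hK.absorption_eq_one hs, one_mul, mul_one]
    · have hstep : ∀ v, M.expDeviation l s t (π ++ [u] ++ [v]) = E := by
        intro v
        rw [hE, expDeviation, expDeviation, departures_snoc, transCount_snoc]
        simp [hu]
      simp only [hstep, ← mul_assoc, ← Finset.sum_mul, sum_P_mul_absorption, le_refl]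

theorem deviationPotential_singleton (K : Finset S) (l : ℝ) (s t u : S) :
    M.deviationPotential K l s t [u] = M.absorption K u := by
  have := M.deviationPotential_snoc K l s t [] u
  simpa [expDeviation, transCount_singleton, departures_singleton] using this

/-- With the parameter `±4 a`, the exponential supermartingale is large whenever the relative
frequency is off by at least `a` after at least `k` departures. This bound holds for all times at
once, with the exponent of Hoeffding's inequality for exactly `k` samples. -/
theorem exp_le_expDeviation_add {k a : ℝ} (ha : 0 ≤ a) {π : List S} {s t : S}
    (hpos : 0 < departures π s) (hk : k ≤ departures π s)
    (hdev : a ≤ |(transCount π s t : ℝ) / departures π s - M.P s t|) :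
    Real.exp (2 * k * a ^ 2)
      ≤ M.expDeviation (4 * a) s t π + M.expDeviation (-(4 * a)) s t π := by
  have hN : (0 : ℝ) < departures π s := by exact_mod_cast hpos
  set N : ℝ := (departures π s : ℝ) with hNdef
  set T : ℝ := (transCount π s t : ℝ) with hT
  have h1 : a * N ≤ |T - N * M.P s t| := by
    have : T - N * M.P s t = (T / N - M.P s t) * N := by field_simp
    rw [this, abs_mul, abs_of_pos hN]
    exact mul_le_mul_of_nonneg_right hdev hN.le
  have h2 : k * a ^ 2 ≤ N * a ^ 2 := mul_le_mul_of_nonneg_right hk (sq_nonneg a)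
  have hp : 0 < M.expDeviation (4 * a) s t π := Real.exp_pos _
  have hn : 0 < M.expDeviation (-(4 * a)) s t π := Real.exp_pos _
  rcases abs_cases (T - N * M.P s t) with ⟨h, -⟩ | ⟨h, -⟩
  · refine le_trans ?_ (le_add_of_nonneg_right hn.le)
    refine Real.exp_le_exp.2 ?_
    have h3 := mul_le_mul_of_nonneg_left h1 ha
    rw [h] at h3
    rw [← hT, ← hNdef]
    linarith
  · refine le_trans ?_ (le_add_of_nonneg_left hp.le)
    refine Real.exp_le_exp.2 ?_
    have h3 := mul_le_mul_of_nonneg_left h1 ha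
    rw [h] at h3
    rw [← hT, ← hNdef]
    linarith

/-- The probability of a bad estimate in a bottom component is controlled by a superharmonic
function that starts below `δ / 2` and is at least `1` when some transition probability of the
component is badly estimated from sufficiently many departures. -/
theorem exists_isSuperharmonic_of_bad_estimate (M : MarkovChain S) {p ε δ : ℝ} (hp : 0 < p)
    (hε : 0 < ε) (hδ : 0 < δ) :
    ∃ V : List S → ℝ, M.IsSuperharmonic V ∧ ∑ s, M.μ s * V [s] ≤ δ / 2 ∧
      ∀ π u K s t, M.IsBottom K → u ∈ K → s ∈ K → t ∈ K → 0 < departures (π ++ [u]) s →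
        sampleThreshold p ε δ K ≤ departures (π ++ [u]) s →
        transPrecision p ε K
          ≤ |(transCount (π ++ [u]) s t : ℝ) / departures (π ++ [u]) s - M.P s t| →
        1 ≤ V (π ++ [u]) := by
  classical
  let A : Finset (Finset S) := Finset.univ.filter M.IsBottom
  have hA : ∀ K ∈ A, M.IsBottom K := fun K hK => (Finset.mem_filter.1 hK).2
  let c : Finset S → ℝ := fun K => δ / (4 * (K.card : ℝ) ^ 2)
  have hc : ∀ K, 0 ≤ c K := fun K => by positivity
  let W : Finset S → S → S → List S → ℝ := fun K s t π =>
    c K * (M.deviationPotential K (4 * transPrecision p ε K) s t π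
      + M.deviationPotential K (-(4 * transPrecision p ε K)) s t π)
  have hW : ∀ K ∈ A, ∀ s ∈ K, ∀ t ∈ K, M.IsSuperharmonic (W K s t) := fun K hK s hs t _ =>
    ((isSuperharmonic_deviationPotential (hA K hK).closed _ hs t).add
      (isSuperharmonic_deviationPotential (hA K hK).closed _ hs t)).const_mul (hc K)
  refine ⟨fun π => ∑ K ∈ A, ∑ s ∈ K, ∑ t ∈ K, W K s t π,
    .sum fun K hK => .sum fun s hs => .sum fun t ht => hW K hK s hs t ht, ?_, ?_⟩
  · have h1 : ∀ x, ∑ K ∈ A, ∑ s ∈ K, ∑ t ∈ K, W K s t [x] ≤ δ / 2 := by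
      intro x
      calc ∑ K ∈ A, ∑ s ∈ K, ∑ t ∈ K, W K s t [x]
          = ∑ K ∈ A, δ / 2 * M.absorption K x := by
            refine Finset.sum_congr rfl fun K hK => ?_
            have hcard : (K.card : ℝ) ≠ 0 := by exact_mod_cast (hA K hK).nonempty.card_pos.ne'
            simp only [W, c, deviationPotential_singleton, Finset.sum_const, nsmul_eq_mul]
            field_simp
            ring
        _ ≤ δ / 2 * 1 := by
            rw [← Finset.mul_sum]
            exact mul_le_mul_of_nonneg_left (sum_absorption_le_one hA x) (by positivity)
        _ = δ / 2 := mul_one _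
    calc _ ≤ ∑ s, M.μ s * (δ / 2) :=
          Finset.sum_le_sum fun s _ => mul_le_mul_of_nonneg_left (h1 s) (M.μ_nonneg s)
      _ = δ / 2 := by rw [← Finset.sum_mul, M.μ_sum, one_mul]
  · intro π u K s t hK hu hs ht hpos hk hdev
    have hKA : K ∈ A := Finset.mem_filter.2 ⟨Finset.mem_univ K, hK⟩
    have ha := transPrecision_pos hp hε hK.nonempty
    have hcard : (0 : ℝ) < K.card := by exact_mod_cast hK.nonempty.card_pos
    have hle : W K s t (π ++ [u]) ≤ ∑ K ∈ A, ∑ s ∈ K, ∑ t ∈ K, W K s t (π ++ [u]) := by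
      refine le_trans ?_ (Finset.single_le_sum
        (f := fun K => ∑ s ∈ K, ∑ t ∈ K, W K s t (π ++ [u])) (fun L hL =>
        Finset.sum_nonneg fun s hs => Finset.sum_nonneg fun t ht => (hW L hL s hs t ht).nonneg _)
        hKA)
      refine le_trans ?_ (Finset.single_le_sum (f := fun s => ∑ t ∈ K, W K s t (π ++ [u]))
        (fun s hs => Finset.sum_nonneg fun t ht => (hW K hKA s hs t ht).nonneg _) hs)
      exact Finset.single_le_sum (f := fun t => W K s t (π ++ [u]))
        (fun t ht => (hW K hKA s hs t ht).nonneg _) ht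
    refine le_trans ?_ hle
    have h1 := exp_le_expDeviation_add (M := M) ha.le hpos hk hdev
    have h2 : 2 * sampleThreshold p ε δ K * transPrecision p ε K ^ 2
        = Real.log (2 * (K.card : ℝ) ^ 2) - Real.log (δ / 2) := by
      rw [sampleThreshold]
      field_simp
    rw [h2, Real.exp_sub, Real.exp_log (by positivity), Real.exp_log (by positivity)] at h1
    simp only [W, deviationPotential_snoc, hK.closed.absorption_eq_one hu, one_mul]
    calc (1 : ℝ) = c K * (2 * (K.card : ℝ) ^ 2 / (δ / 2)) := by
          simp only [c]
          field_simp
          norm_num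
      _ ≤ _ := mul_le_mul_of_nonneg_left h1 (hc K)

end MarkovChain

/-! ### Recurring transitions -/

namespace PathGraph

section Drop

variable {S : Type*}

theorem drop_pathTo_succ (ρ : ℕ → S) {m n : ℕ} (h : m ≤ n) :
    (pathTo ρ (n + 1)).drop m
      = ((List.range n).map ρ).drop m ++ [ρ n] ++ [ρ (n + 1)] := by
  rw [pathTo_succ, pathTo_eq_append, List.drop_append_of_le_length (by simp; omega),
    List.drop_append_of_le_length (by simpa using h)]

theorem drop_pathTo (ρ : ℕ → S) {m n : ℕ} (h : m ≤ n) :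
    (pathTo ρ n).drop m = ((List.range n).map ρ).drop m ++ [ρ n] := by
  rw [pathTo_eq_append, List.drop_append_of_le_length (by simpa using h)]

theorem exists_of_mem_drop_pathTo {ρ : ℕ → S} {m n : ℕ} {x : S}
    (h : x ∈ (pathTo ρ n).drop m) : ∃ i, m ≤ i ∧ ρ i = x := by
  obtain ⟨j, hj, rfl⟩ := List.mem_drop_iff_getElem.1 h
  exact ⟨j + m, by omega, by simp [pathTo, add_comm]⟩

theorem edge_drop_pathTo (ρ : ℕ → S) {m i n : ℕ} (hm : m ≤ i) (hn : i + 1 ≤ n) :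
    Edge ((pathTo ρ n).drop m) (ρ i) (ρ (i + 1)) := by
  have h1 : (pathTo ρ (i + 1)).drop m <+: (pathTo ρ n).drop m := (pathTo_prefix ρ hn).drop m
  refine Edge.mono h1.isInfix ?_
  rw [drop_pathTo_succ ρ hm]
  exact ⟨((List.range i).map ρ).drop m, [], by simp⟩

theorem transGen_drop_pathTo (ρ : ℕ → S) {m i j n : ℕ} (hm : m ≤ i) (hij : i < j) (hn : j ≤ n) :
    Relation.TransGen (Edge ((pathTo ρ n).drop m)) (ρ i) (ρ j) := by
  induction j, hij using Nat.le_induction with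
  | base => exact .single (edge_drop_pathTo ρ hm hn)
  | succ j hij ih =>
    exact (ih (by omega)).tail (edge_drop_pathTo ρ (by omega) hn)

end Drop

variable {S : Type*} [DecidableEq S]

theorem departures_drop_pathTo_succ (ρ : ℕ → S) {m n : ℕ} (h : m ≤ n) (s : S) :
    departures ((pathTo ρ (n + 1)).drop m) s
      = departures ((pathTo ρ n).drop m) s + if s = ρ n then 1 else 0 := by
  rw [drop_pathTo_succ ρ h, departures_snoc, drop_pathTo ρ h]

theorem monotone_departures_drop_pathTo (ρ : ℕ → S) (m : ℕ) (s : S) :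
    Monotone fun n => departures ((pathTo ρ n).drop m) s := by
  refine monotone_nat_of_le_succ fun n => ?_
  rcases le_or_gt m n with h | h
  · simp only [departures_drop_pathTo_succ ρ h]
    omega
  · have h0 : (pathTo ρ n).drop m = [] := List.drop_eq_nil_of_le (by rw [length_pathTo]; omega)
    simp [h0, departures]

theorem tendsto_departures {ρ : ℕ → S} {s : S} (hs : ∃ᶠ n in atTop, ρ n = s) (m : ℕ) :
    Tendsto (fun n => departures ((pathTo ρ n).drop m) s) atTop atTop := by
  have hmono := monotone_departures_drop_pathTo ρ m s
  refine tendsto_atTop_atTop_of_monotone hmono fun N => ?_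
  induction N with
  | zero => exact ⟨0, Nat.zero_le _⟩
  | succ N ih =>
    obtain ⟨n, hn⟩ := ih
    obtain ⟨k, hk, hks⟩ := frequently_atTop.1 hs (max n m)
    refine ⟨k + 1, ?_⟩
    have h1 := hn.trans (hmono ((le_max_left n m).trans hk))
    simp only at h1 ⊢
    rw [departures_drop_pathTo_succ ρ ((le_max_right n m).trans hk), if_pos hks.symm]
    omega

theorem transCount_drop_pathTo_eq_zero {ρ : ℕ → S} {s t : S} {m : ℕ}
    (h : ∀ n, m ≤ n → ¬ (ρ n = s ∧ ρ (n + 1) = t)) (n : ℕ) :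
    transCount ((pathTo ρ n).drop m) s t = 0 := by
  induction n with
  | zero =>
    rw [pathTo_zero]
    cases m <;> simp [transCount]
  | succ n ih =>
    rcases le_or_gt m n with hmn | hmn
    · rw [drop_pathTo_succ ρ hmn, transCount_snoc, ← drop_pathTo ρ hmn, ih, if_neg]
      exact fun h' => h n hmn ⟨h'.1.symm, h'.2.symm⟩
    · have hlen : ((pathTo ρ (n + 1)).drop m).length ≤ 1 := by
        rw [List.length_drop, length_pathTo]
        omega
      rcases hl : (pathTo ρ (n + 1)).drop m with _ | ⟨a, _ | ⟨b, l⟩⟩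
      · simp [transCount]
      · simp [transCount]
      · rw [hl] at hlen
        simp at hlen

end PathGraph

namespace MarkovChain

open PathGraph

variable {S : Type*} [Fintype S] {M : MarkovChain S}

theorem isPath_pathTo {ρ : ℕ → S} (h : ∀ n, 0 < M.P (ρ n) (ρ (n + 1))) (n : ℕ) :
    M.IsPath (pathTo ρ n) := by
  induction n with
  | zero => exact fun s t hst => absurd hst (not_edge_singleton _ s t)
  | succ n ih =>
    intro s t hst
    rw [pathTo_succ, pathTo_eq_append, edge_snoc, ← pathTo_eq_append] at hst
    rcases hst with hst | ⟨rfl, rfl⟩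
    exacts [ih s t hst, h n]

variable [DecidableEq S]

variable (M) in
/-- The evidence that the transition from `s` to `t` is not taken from time `m` on: each departure
from `s` multiplies it by `a`, the transition to `t` sets it to zero. -/
noncomputable def avoidance (a : ℝ) (m : ℕ) (s t : S) (π : List S) : ℝ :=
  if transCount (π.drop m) s t = 0 then a ^ departures (π.drop m) s else 0

theorem isSuperharmonic_avoidance {a : ℝ} (m : ℕ) {s t : S} (ha : 1 ≤ a)
    (hP : a * (1 - M.P s t) ≤ 1) : M.IsSuperharmonic (avoidance a m s t) := by
  have ha0 : 0 ≤ a := by linarith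
  refine ⟨fun π => ?_, fun π u => ?_⟩
  · unfold avoidance
    split_ifs
    exacts [by positivity, le_rfl]
  set W := avoidance a m s t (π ++ [u]) with hW
  have hW0 : 0 ≤ W := by
    rw [hW, avoidance]
    split_ifs
    exacts [by positivity, le_rfl]
  rcases le_or_gt m π.length with hm | hm
  · have hle : ∀ v, avoidance a m s t (π ++ [u] ++ [v])
        = W * if s = u then (if t = v then 0 else a) else 1 := by
      intro v
      rw [hW, avoidance, avoidance,
        List.drop_append_of_le_length (l₁ := π ++ [u]) (by simp; omega),
        List.drop_append_of_le_length hm, transCount_snoc, departures_snoc]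
      by_cases hsu : s = u
      · by_cases htv : t = v
        · simp [hsu, htv]
        · simp [hsu, htv, pow_succ]
      · simp [hsu]
    simp only [hle, mul_left_comm _ W, ← Finset.mul_sum]
    refine mul_le_of_le_one_right hW0 ?_
    split_ifs with hsu
    · subst hsu
      have h1 := Finset.add_sum_erase Finset.univ
        (fun v => M.P s v * (if t = v then 0 else a)) (Finset.mem_univ t)
      have h2 := Finset.add_sum_erase Finset.univ (fun v => M.P s v) (Finset.mem_univ t)
      have h3 : ∑ v ∈ Finset.univ.erase t, M.P s v * (if t = v then 0 else a)
          = a * ∑ v ∈ Finset.univ.erase t, M.P s v := by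
        rw [Finset.mul_sum]
        refine Finset.sum_congr rfl fun v hv => ?_
        rw [if_neg (Finset.ne_of_mem_erase hv).symm, mul_comm]
      rw [if_pos rfl, mul_zero, zero_add] at h1
      rw [M.P_sum] at h2
      rw [← h1, h3, eq_sub_of_add_eq' h2]
      exact hP
    · simp [M.P_sum]
  · have h1 : (π ++ [u]).drop m = [] := List.drop_eq_nil_of_le (by simp; omega)
    have hle : ∀ v, avoidance a m s t (π ++ [u] ++ [v]) = 1 := by
      intro v
      rw [avoidance, List.drop_append, h1, List.nil_append]
      rcases m - (π ++ [u]).length with _ | k <;> simp [transCount, departures]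
    have hW1 : W = 1 := by
      rw [hW, avoidance, h1]
      simp [transCount, departures]
    simp only [hle, hW1, mul_one, M.P_sum, le_refl]

variable [MeasurableSpace S] [DiscreteMeasurableSpace S]

theorem ae_frequently_transition_of_pos {s t : S} (hP : 0 < M.P s t) (m : ℕ) :
    ∀ᵐ ρ ∂M.runMeasure, ¬ ((∃ᶠ n in atTop, ρ n = s) ∧
      ∀ n, m ≤ n → ¬ (ρ n = s ∧ ρ (n + 1) = t)) := by
  have hP1 : M.P s t ≤ 1 := by
    rw [← M.P_sum s]
    exact Finset.single_le_sum (fun v _ => M.P_nonneg s v) (Finset.mem_univ t)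
  set a : ℝ := 1 + M.P s t with ha
  have hV := isSuperharmonic_avoidance (M := M) (a := a) m (s := s) (t := t) (by linarith)
    (by rw [ha]; nlinarith)
  rw [ae_iff]
  simp only [not_not]
  refine le_antisymm (ENNReal.le_of_forall_pos_le_add fun c hc _ => ?_) zero_le
  have hc' : (0 : ℝ) < c := hc
  rw [zero_add]
  refine le_trans (measure_mono ?_) ((hV.const_mul hc'.le).measure_exists_le.trans ?_)
  · rintro ρ ⟨h1, h2⟩
    obtain ⟨N, hN⟩ := pow_unbounded_of_one_lt (c : ℝ)⁻¹ (by linarith : 1 < a)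
    obtain ⟨n, hn⟩ := ((tendsto_departures h1 m).eventually_ge_atTop N).exists
    refine ⟨n, ?_⟩
    rw [avoidance, if_pos (transCount_drop_pathTo_eq_zero h2 n)]
    have h3 : (c : ℝ)⁻¹ ≤ a ^ departures ((pathTo ρ n).drop m) s :=
      hN.le.trans (pow_le_pow_right₀ (by linarith) hn)
    calc (1 : ℝ) = c * (c : ℝ)⁻¹ := (mul_inv_cancel₀ hc'.ne').symm
      _ ≤ _ := mul_le_mul_of_nonneg_left h3 hc'.le
  · have h1 : ∀ x : S, avoidance a m s t [x] = 1 := fun x => by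
      rw [avoidance]
      rcases m with _ | m <;> simp [transCount, departures]
    simp [h1, ← Finset.sum_mul, M.μ_sum]

/-- Almost surely, a possible transition from a state that recurs is taken again and again. -/
theorem ae_frequently_transition (M : MarkovChain S) :
    ∀ᵐ ρ ∂M.runMeasure, ∀ s t, 0 < M.P s t → (∃ᶠ n in atTop, ρ n = s) →
      ∃ᶠ n in atTop, ρ n = s ∧ ρ (n + 1) = t := by
  have h : ∀ᵐ ρ ∂M.runMeasure, ∀ s t, 0 < M.P s t → ∀ m, ¬ ((∃ᶠ n in atTop, ρ n = s) ∧
      ∀ n, m ≤ n → ¬ (ρ n = s ∧ ρ (n + 1) = t)) := by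
    simp only [ae_all_iff]
    exact fun s t hP m => ae_frequently_transition_of_pos hP m
  filter_upwards [h] with ρ hρ s t hP hs
  rw [frequently_atTop]
  intro m
  by_contra! hc
  exact hρ s t hP m ⟨hs, fun n hn h' => hc n hn h'.1 h'.2⟩

end MarkovChain

/-! ### Almost sure termination -/

namespace PathGraph

open MarkovChain

theorem departures_le_count {S : Type*} [DecidableEq S] (π : List S) (s : S) :
    departures π s ≤ π.count s :=
  (List.dropLast_sublist π).count_le s

variable {S : Type*} [Fintype S] {M : MarkovChain S} {ρ : ℕ → S}

open Classical in
/-- The states that a run visits infinitely often. -/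
noncomputable def recurrentStates (ρ : ℕ → S) : Finset S :=
  Finset.univ.filter fun s => ∃ᶠ n in atTop, ρ n = s

theorem mem_recurrentStates {s : S} : s ∈ recurrentStates ρ ↔ ∃ᶠ n in atTop, ρ n = s := by
  simp [recurrentStates]

theorem eventually_mem_recurrentStates (ρ : ℕ → S) :
    ∀ᶠ n in atTop, ρ n ∈ recurrentStates ρ := by
  have h : ∀ᶠ n in atTop, ∀ s, s ∉ recurrentStates ρ → ρ n ≠ s :=
    eventually_all.2 fun s => by
      by_cases hs : s ∈ recurrentStates ρ
      · exact Eventually.of_forall fun n h => absurd hs h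
      · filter_upwards [not_frequently.1 (mt mem_recurrentStates.2 hs)] with n hn _ using hn
  filter_upwards [h] with n hn
  by_contra h'
  exact hn _ h' rfl

theorem nonempty_recurrentStates (ρ : ℕ → S) : (recurrentStates ρ).Nonempty :=
  let ⟨n, hn⟩ := (eventually_mem_recurrentStates ρ).exists
  ⟨ρ n, hn⟩

theorem isClosedSet_recurrentStates
    (hrec : ∀ s t, 0 < M.P s t → (∃ᶠ n in atTop, ρ n = s) →
      ∃ᶠ n in atTop, ρ n = s ∧ ρ (n + 1) = t) : M.IsClosedSet (recurrentStates ρ) := by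
  intro s hs t ht
  by_contra h
  refine ht (mem_recurrentStates.2 ?_)
  have h1 := hrec s t ((M.P_nonneg s t).lt_of_ne' h) (mem_recurrentStates.1 hs)
  rw [frequently_atTop] at h1 ⊢
  intro m
  obtain ⟨n, hn, -, hnt⟩ := h1 m
  exact ⟨n + 1, by omega, hnt⟩

/-- From any time on, the run eventually exhibits the strong connectedness of its recurrent
states. -/
theorem eventually_isSC (ρ : ℕ → S) (m : ℕ) :
    ∀ᶠ n in atTop, IsSC (Edge ((pathTo ρ n).drop m)) (recurrentStates ρ) := by
  have h : ∀ᶠ n in atTop, ∀ s t, s ∈ recurrentStates ρ → t ∈ recurrentStates ρ →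
      Relation.TransGen (Edge ((pathTo ρ n).drop m)) s t := by
    refine eventually_all.2 fun s => eventually_all.2 fun t => ?_
    by_cases hst : s ∈ recurrentStates ρ ∧ t ∈ recurrentStates ρ
    · obtain ⟨i, hi, rfl⟩ := frequently_atTop.1 (mem_recurrentStates.1 hst.1) m
      obtain ⟨j, hj, rfl⟩ := frequently_atTop.1 (mem_recurrentStates.1 hst.2) (i + 1)
      filter_upwards [eventually_ge_atTop j] with n hn _ _
      exact transGen_drop_pathTo ρ hi hj hn
    · exact Eventually.of_forall fun n h1 h2 => absurd ⟨h1, h2⟩ hst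
  filter_upwards [h] with n hn
  exact ⟨nonempty_recurrentStates ρ, fun s hs t ht => hn s t hs ht⟩

variable [DecidableEq S]

theorem eventually_le_count (ρ : ℕ → S) (m N : ℕ) :
    ∀ᶠ n in atTop, ∀ s ∈ recurrentStates ρ, N ≤ ((pathTo ρ n).drop m).count s := by
  have h : ∀ᶠ n in atTop, ∀ s, s ∈ recurrentStates ρ → N ≤ ((pathTo ρ n).drop m).count s := by
    refine eventually_all.2 fun s => ?_
    by_cases hs : s ∈ recurrentStates ρ
    · filter_upwards [(tendsto_departures (mem_recurrentStates.1 hs) m).eventually_ge_atTop N]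
        with n hn _
      exact hn.trans (departures_le_count _ _)
    · exact Eventually.of_forall fun n h => absurd h hs
  exact h

theorem eventually_toFinset_eq {m : ℕ} (hm : ∀ n, m ≤ n → ρ n ∈ recurrentStates ρ) :
    ∀ᶠ n in atTop, ((pathTo ρ n).drop m).toFinset = recurrentStates ρ := by
  filter_upwards [eventually_le_count ρ m 1] with n hn
  ext x
  rw [List.mem_toFinset]
  constructor
  · intro hx
    obtain ⟨i, hi, rfl⟩ := exists_of_mem_drop_pathTo hx
    exact hm i hi
  · exact fun hx => List.count_pos_iff.1 (hn x hx)

/-- On a run that takes possible transitions only, and all of those again and again that it could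
take again and again, the set of recurrent states becomes a strong `k`-candidate for any `k`,
and the index of the candidate becomes constant. -/
theorem exists_eventually_isStrongKCandidate (hpos : ∀ n, 0 < M.P (ρ n) (ρ (n + 1)))
    (hrec : ∀ s t, 0 < M.P s t → (∃ᶠ n in atTop, ρ n = s) →
      ∃ᶠ n in atTop, ρ n = s ∧ ρ (n + 1) = t) :
    ∃ i, 1 ≤ i ∧ ∀ k : ℝ, ∀ᶠ n in atTop, candidateIndex (pathTo ρ n) = i ∧
      IsCandidate (pathTo ρ n) (recurrentStates ρ) ∧
      IsStrongKCandidate k (recurrentStates ρ) (pathTo ρ n) := by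
  set K := recurrentStates ρ with hK
  have hcl := isClosedSet_recurrentStates hrec
  rw [← hK] at hcl
  have hedge : ∀ n, ∀ s ∈ K, ∀ t, t ∉ K → ¬ Edge (pathTo ρ n) s t := fun n s hs t ht he =>
    (isPath_pathTo hpos n s t he).ne' (hcl s hs t ht)
  -- `e` is the time of the first visit to `K`.
  have hex : ∃ n, ρ n ∈ K := (eventually_mem_recurrentStates ρ).exists
  classical
  set e := Nat.find hex with he
  have hmem : ∀ n, e ≤ n → ρ n ∈ K := by
    intro n hn
    induction n, hn using Nat.le_induction with
    | base => exact Nat.find_spec hex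
    | succ n _ ih =>
      by_contra h
      exact (hpos n).ne' (hcl _ ih _ h)
  have hcand : ∀ᶠ n in atTop, IsCandidate (pathTo ρ n) K := by
    filter_upwards [eventually_isSC ρ e, eventually_toFinset_eq hmem] with n h1 h2
    exact ⟨_, List.drop_suffix e _, h2, isBSCC_iff.2 ⟨⟨h1.1, fun s hs t ht =>
      Relation.TransGen.mono (fun a b hab => Edge.mono (List.drop_suffix e _).isInfix hab) _ _
        (h1.2 s hs t ht)⟩, hedge n⟩⟩
  -- `n₀` is the time at which `K` becomes the candidate.
  have hex₀ : ∃ n, IsCandidate (pathTo ρ n) K := hcand.exists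
  set n₀ := Nat.find hex₀ with hn₀
  have hc₀ : IsCandidate (pathTo ρ n₀) K := Nat.find_spec hex₀
  have hen : e ≤ n₀ := by
    obtain ⟨π', u, h1, h2⟩ := hc₀.exists_eq_snoc
    rw [pathTo_eq_append] at h1
    obtain ⟨-, h3⟩ := List.append_inj' h1 rfl
    simp only [List.cons.injEq, and_true] at h3
    exact Nat.find_min' hex (h3 ▸ h2)
  have hstay : ∀ n, n₀ ≤ n → IsCandidate (pathTo ρ n) K ∧
      candidateIndex (pathTo ρ n) = candidateIndex (pathTo ρ n₀) := by
    intro n hn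
    induction n, hn using Nat.le_induction with
    | base => exact ⟨hc₀, rfl⟩
    | succ n hn ih =>
      have hmem' : ρ (n + 1) ∈ K := hmem _ (by omega)
      rw [pathTo_succ]
      exact ⟨ih.1.snoc hmem', (candidateIndex_of_candidate ih.1 hmem').trans ih.2⟩
  refine ⟨candidateIndex (pathTo ρ n₀), candidateIndex_pos (loopState_fst_of_candidate hc₀),
    fun k => ?_⟩
  filter_upwards [eventually_ge_atTop n₀, eventually_isSC ρ n₀,
    eventually_toFinset_eq (m := n₀) fun n hn => hmem n (hen.trans hn),
    eventually_toFinset_eq hmem, eventually_le_count ρ n₀ ⌈k + 1⌉₊] with n hn h1 h2 h3 h4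
  refine ⟨(hstay n hn).2, (hstay n hn).1, ?_⟩
  have hdrop : (pathTo ρ n).drop n₀ = ρ n₀ :: (pathTo ρ n).drop (n₀ + 1) := by
    rw [List.drop_eq_getElem_cons (by rw [length_pathTo]; omega)]
    simp [pathTo]
  have htake : (pathTo ρ n).take n₀ = (List.range n₀).map ρ := by
    rw [pathTo, ← List.map_take, List.take_range, min_eq_left (by omega)]
  have hsplit : (pathTo ρ n).take e ++ ((pathTo ρ n).take n₀).drop e = (pathTo ρ n).take n₀ := by
    conv_rhs => rw [← List.take_append_drop e ((pathTo ρ n).take n₀)]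
    rw [List.take_take, min_eq_left hen]
  have hsplit' : ((pathTo ρ n).take n₀).drop e ++ (pathTo ρ n).drop n₀ = (pathTo ρ n).drop e := by
    conv_rhs => rw [← List.take_append_drop n₀ (pathTo ρ n)]
    rw [List.drop_append_of_le_length (by rw [List.length_take, length_pathTo]; omega)]
  refine ⟨(pathTo ρ n).take e, ((pathTo ρ n).take n₀).drop e, (pathTo ρ n).drop (n₀ + 1), ρ n₀,
    ?_, ?_, ?_, ?_, ?_, ?_⟩
  · rw [hsplit, ← hdrop, List.take_append_drop]
  · intro s hs hsK
    rw [pathTo, ← List.map_take, List.take_range, List.mem_map] at hs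
    obtain ⟨j, hj, rfl⟩ := hs
    rw [List.mem_range] at hj
    exact Nat.find_min hex (lt_of_lt_of_le hj (min_le_left _ _)) hsK
  · rw [← hdrop, hsplit', h3]
  · rw [hsplit, htake, Ne, candidate_eq_some]
    rcases hz : n₀ with _ | j
    · intro h
      obtain ⟨π', u, h', -⟩ := h.exists_eq_snoc
      simp at h'
    · exact Nat.find_min hex₀ (m := j) (by omega)
  · rw [hsplit, htake, ← pathTo_eq_append, candidate_eq_some]
    exact hc₀
  · rw [← hdrop]
    have hk : ∀ s ∈ K, k + 1 ≤ (((pathTo ρ n).drop n₀).count s : ℝ) := fun s hs =>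
      (Nat.le_ceil _).trans (by exact_mod_cast h4 s hs)
    refine ⟨_, List.suffix_rfl, h2, isBSCC_iff.2 ⟨h1, fun s hs t ht hst => ?_⟩, fun s hs => ?_,
      fun s hs => ?_⟩
    · exact hedge n s hs t ht (hst.mono (List.drop_suffix _ _).isInfix)
    · linarith [hk s hs]
    · refine hk s ?_
      change s ∈ recurrentStates ρ
      rw [← h2, List.mem_toFinset]
      exact List.mem_of_getLast? hs

theorem ae_terminates [MeasurableSpace S] [DiscreteMeasurableSpace S] (M : MarkovChain S)
    (p ε δ : ℝ) : ∀ᵐ ρ ∂M.runMeasure, Terminates p ε δ ρ := by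
  filter_upwards [M.ae_P_pos, M.ae_frequently_transition] with ρ hpos hrec
  obtain ⟨i, hi, h⟩ := exists_eventually_isStrongKCandidate hpos hrec
  obtain ⟨n, ⟨hin, hc, h1⟩, -, -, h2⟩ := ((h (bsccThreshold p (δ / 2) i)).and
    (h (sampleThreshold p ε δ (recurrentStates ρ)))).exists
  exact ⟨n, ⟨hin.symm ▸ hi, _, candidate_eq_some.2 hc, hin.symm ▸ h1⟩, _,
    candidate_eq_some.2 hc, h2⟩

end PathGraph

/-! ### The returned value -/

namespace PathGraph

open MarkovChain

theorem sampleThreshold_pos {S : Type*} {p ε δ : ℝ} (hp : 0 < p) (hε : 0 < ε) (hδ : 0 < δ)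
    (hδ1 : δ < 1) {K : Finset S} (hK : K.Nonempty) : 0 < sampleThreshold p ε δ K := by
  have hcard : (1 : ℝ) ≤ K.card := by exact_mod_cast hK.card_pos
  have h1 : 0 < Real.log (2 * (K.card : ℝ) ^ 2) := Real.log_pos (by nlinarith)
  have h2 : Real.log (δ / 2) < 0 := Real.log_neg (by linarith) (by linarith)
  have := transPrecision_pos hp hε hK
  unfold sampleThreshold
  have h3 : 0 < Real.log (2 * (K.card : ℝ) ^ 2) - Real.log (δ / 2) := by linarith
  positivity

variable {S : Type*} [Fintype S] [DecidableEq S] [MeasurableSpace S] [DiscreteMeasurableSpace S]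
  {M : MarkovChain S} {r : S → ℝ} {p ε δ : ℝ}

theorem meanPayoff_empiricalChain (π : List S) (u : S) :
    (empiricalChain π u).meanPayoff r = (empiricalChain π u).ergodicLimit r u := by
  rw [meanPayoff_eq]
  simp [empiricalChain]

/-- In a bottom component, estimates with the required precision give a mean payoff with error at
most `ε`. -/
theorem abs_meanPayoff_empiricalChain_sub_le (hpM : p ≤ M.pMin) (hε : 0 < ε)
    (hε1 : ε < 1) (hr : ∀ s, r s ∈ Set.Icc (0 : ℝ) 1) {π : List S} {K : Finset S} {u v : S}
    (hK : M.IsBottom K) (hu : u ∈ K) (hv : v ∈ K) (hπ : M.IsPath π)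
    (hpos : ∀ s ∈ K, 0 < departures π s)
    (hest : ∀ s ∈ K, ∀ t ∈ K,
      |(transCount π s t : ℝ) / departures π s - M.P s t| < transPrecision p ε K) :
    |(empiricalChain π u).meanPayoff r - M.ergodicLimit r v| ≤ ε := by
  have hcard : 1 ≤ K.card := hK.nonempty.card_pos
  set q : ℝ := (1 + ε) ^ (1 / (2 * (K.card : ℝ))) - 1 with hq
  have hq0 : 0 < q := sub_pos.2 (Real.one_lt_rpow (by linarith) (by positivity))
  have hq1 : q < 1 := by
    have hexp : 1 / (2 * (K.card : ℝ)) ≤ 1 := by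
      have : (1 : ℝ) ≤ K.card := by exact_mod_cast hcard
      rw [div_le_one (by linarith)]
      linarith
    have := Real.rpow_le_rpow_of_exponent_le (by linarith : 1 ≤ 1 + ε) hexp
    rw [Real.rpow_one] at this
    linarith
  have hpow : (1 + q) ^ (2 * K.card) = 1 + ε := by
    rw [hq, add_sub_cancel, ← Real.rpow_natCast, ← Real.rpow_mul (by linarith)]
    have : (K.card : ℝ) ≠ 0 := by positivity
    push_cast
    rw [one_div, inv_mul_cancel₀ (by positivity), Real.rpow_one]
  have hP : ∀ s ∈ K, ∀ t,
      (empiricalChain π u).P s t = (transCount π s t : ℝ) / departures π s := fun s hs t => by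
    simp only [empiricalChain, sum_transCount]
    rw [if_neg (hpos s hs).ne']
  have habs : ∀ s ∈ K, ∀ t, |(empiricalChain π u).P s t - M.P s t| ≤ q * M.P s t := by
    intro s hs t
    rw [hP s hs]
    rcases (M.P_nonneg s t).eq_or_lt with h0 | h0
    · have : transCount π s t = 0 := by
        by_contra h
        exact (hπ s t (edge_of_transCount_pos (Nat.pos_of_ne_zero h))).ne h0
      simp [this, ← h0]
    · have ht : t ∈ K := by
        by_contra ht
        exact h0.ne' (hK.closed s hs t ht)
      refine (hest s hs t ht).le.trans ?_
      rw [transPrecision, ← hq, mul_comm]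
      exact mul_le_mul_of_nonneg_left (M.le_P_of_le_pMin hpM h0) hq0.le
  have h := abs_ergodicLimit_sub_le (M := M) (M' := empiricalChain π u) hK.irreducible hK.closed
    hq0.le hq1 (fun s hs t => by linarith [(abs_le.1 (habs s hs t)).1])
    (fun s hs t => by linarith [(abs_le.1 (habs s hs t)).2]) hr hv hu
  rw [hpow] at h
  rw [meanPayoff_empiricalChain]
  linarith

open Classical in
theorem singlePathMP_eq {ρ : ℕ → S} {n : ℕ} (h : StopsAt p ε δ (pathTo ρ n))
    (hmin : ∀ m < n, ¬ StopsAt p ε δ (pathTo ρ m)) :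
    singlePathMP r p ε δ ρ = (empiricalChain (pathTo ρ n) (ρ n)).meanPayoff r := by
  have hT : ∃ n, StopsAt p ε δ (pathTo ρ n) := ⟨n, h⟩
  have hfind : Nat.find hT = n := (Nat.find_eq_iff hT).2 ⟨h, hmin⟩
  calc singlePathMP r p ε δ ρ
      = (empiricalChain (pathTo ρ (Nat.find hT)) (ρ (Nat.find hT))).meanPayoff r := dif_pos hT
    _ = _ := by rw [hfind]

theorem singlePathMP_mem_Icc (hr : ∀ s, r s ∈ Set.Icc (0 : ℝ) 1) (ρ : ℕ → S) :
    singlePathMP r p ε δ ρ ∈ Set.Icc (0 : ℝ) 1 := by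
  unfold singlePathMP
  split_ifs
  · exact meanPayoff_mem_Icc _ hr
  · simp

theorem measurable_singlePathMP : Measurable (singlePathMP (S := S) r p ε δ) := by
  intro B _
  let value : List S → ℝ := fun π => π.getLast?.elim 0 fun s => (empiricalChain π s).meanPayoff r
  have hvalue : ∀ (ρ : ℕ → S) n, value (pathTo ρ n)
      = (empiricalChain (pathTo ρ n) (ρ n)).meanPayoff r := fun ρ n => by
    simp only [value, pathTo_eq_append, List.getLast?_concat, Option.elim_some]
  have hset : singlePathMP r p ε δ ⁻¹' B
      = (⋃ n, {ρ : ℕ → S | StopsAt p ε δ (pathTo ρ n) ∧ value (pathTo ρ n) ∈ B} ∩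
          ⋂ m, ⋂ (_ : m < n), {ρ | StopsAt p ε δ (pathTo ρ m)}ᶜ) ∪
        ((⋃ n, {ρ | StopsAt p ε δ (pathTo ρ n)})ᶜ ∩ {_ρ | (0 : ℝ) ∈ B}) := by
    classical
    ext ρ
    simp only [Set.mem_preimage, Set.mem_union, Set.mem_iUnion, Set.mem_inter_iff,
      Set.mem_ofPred_eq, Set.mem_iInter, Set.mem_compl_iff, hvalue]
    by_cases hT : ∃ n, StopsAt p ε δ (pathTo ρ n)
    · constructor
      · intro h
        refine Or.inl ⟨Nat.find hT, ⟨Nat.find_spec hT, ?_⟩, fun m hm => Nat.find_min hT hm⟩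
        rwa [← singlePathMP_eq (Nat.find_spec hT) fun m hm => Nat.find_min hT hm]
      · rintro (⟨n, ⟨h1, h2⟩, h3⟩ | ⟨h1, -⟩)
        · rwa [singlePathMP_eq h1 h3]
        · exact absurd hT h1
    · have h0 : singlePathMP r p ε δ ρ = 0 := dif_neg hT
      rw [h0]
      constructor
      · exact fun h => Or.inr ⟨hT, h⟩
      · rintro (⟨n, ⟨h1, -⟩, -⟩ | ⟨-, h⟩)
        · exact absurd ⟨n, h1⟩ hT
        · exact h
  rw [hset]
  refine .union (.iUnion fun n => .inter ?_ (.iInter fun m => .iInter fun _ => .compl ?_))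
    (.inter (.compl (.iUnion fun n => ?_)) (.const _))
  · exact measurableSet_pathTo (fun π => StopsAt p ε δ π ∧ value π ∈ B) n
  · exact measurableSet_pathTo _ m
  · exact measurableSet_pathTo _ n

theorem integrable_singlePathMP (hr : ∀ s, r s ∈ Set.Icc (0 : ℝ) 1) (ν : Measure (ℕ → S))
    [IsFiniteMeasure ν] : Integrable (singlePathMP r p ε δ) ν :=
  Integrable.of_mem_Icc 0 1 measurable_singlePathMP.aemeasurable
    (ae_of_all _ (singlePathMP_mem_Icc hr))

/-- A superharmonic function that starts below `δ` and stays below `1` only on runs on which the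
returned value is within `ε` of the mean payoff from any later state of the run. -/
theorem exists_isSuperharmonic_of_error (hp : 0 < p) (hpM : p ≤ M.pMin) (hε : 0 < ε)
    (hε1 : ε < 1) (hδ : 0 < δ) (hδ1 : δ < 1) (hr : ∀ s, r s ∈ Set.Icc (0 : ℝ) 1) :
    ∃ V : List S → ℝ, M.IsSuperharmonic V ∧ ∑ s, M.μ s * V [s] ≤ δ ∧
      ∀ ρ : ℕ → S, (∀ n, 0 < M.P (ρ n) (ρ (n + 1))) → (∀ n, V (pathTo ρ n) < 1) →
        ∀ m n, m ≤ n → StopsAt p ε δ (pathTo ρ m) →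
          |singlePathMP r p ε δ ρ - M.ergodicLimit r (ρ n)| ≤ ε := by
  obtain ⟨V, hV, hV0, hV1⟩ := exists_isSuperharmonic_of_false_answer hp hpM (half_pos hδ)
  obtain ⟨W, hW, hW0, hW1⟩ := exists_isSuperharmonic_of_bad_estimate M hp hε hδ
  refine ⟨_, hV.add hW, ?_, fun ρ hρ hlt m n hmn hm => ?_⟩
  · simp only [mul_add, Finset.sum_add_distrib]
    linarith
  classical
  have hT : ∃ m, StopsAt p ε δ (pathTo ρ m) := ⟨m, hm⟩
  set k := Nat.find hT with hk
  have hkn : k ≤ n := (Nat.find_min' hT hm).trans hmn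
  have hfirst : StopsAt p ε δ (pathTo ρ k) := Nat.find_spec hT
  have hpath := isPath_pathTo hρ k
  obtain ⟨hreach, K, hKc, hstrong⟩ := hfirst
  have hKc' := candidate_eq_some.1 hKc
  have hcl : M.IsClosedSet K := by
    by_contra h
    have h1 := hV1 _ K hpath hreach hKc' h
    linarith [hlt k, hW.nonneg (pathTo ρ k)]
  have hbot : M.IsBottom K := by
    obtain ⟨κ, -, -, hκ⟩ := hKc'
    exact ⟨hκ.1.1, hcl, fun s hs t ht =>
      (Relation.TransGen.mono hpath _ _ (hκ.1.2 s hs t ht)).to_reflTransGen⟩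
  have hkK : ρ k ∈ K := by
    obtain ⟨π', u, h1, h2⟩ := hKc'.exists_eq_snoc
    rw [pathTo_eq_append] at h1
    obtain ⟨-, h3⟩ := List.append_inj' h1 rfl
    simp only [List.cons.injEq, and_true] at h3
    exact h3 ▸ h2
  have hstay : ∀ n, k ≤ n → ρ n ∈ K := fun n hn => by
    induction n, hn using Nat.le_induction with
    | base => exact hkK
    | succ n _ ih =>
      by_contra h
      exact (hρ n).ne' (hcl _ ih _ h)
  have hdep : ∀ s ∈ K, 0 < departures (pathTo ρ k) s := fun s hs => by
    exact_mod_cast (sampleThreshold_pos hp hε hδ hδ1 hbot.nonempty).trans_le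
      (hstrong.le_departures hs)
  rw [singlePathMP_eq (Nat.find_spec hT) fun m hm => Nat.find_min hT hm]
  refine abs_meanPayoff_empiricalChain_sub_le hpM hε hε1 hr hbot hkK (hstay n hkn) hpath hdep
    fun s hs t ht => ?_
  by_contra! h
  have h1 : 1 ≤ W (pathTo ρ k) := by
    rw [pathTo_eq_append]
    refine hW1 _ _ K s t hbot hkK hs ht ?_ ?_ ?_ <;> rw [← pathTo_eq_append]
    exacts [hdep s hs, hstrong.le_departures hs, h]
  linarith [hlt k, hV.nonneg (pathTo ρ k)]

theorem abs_integral_singlePathMP_sub_le (hp : 0 < p) (hpM : p ≤ M.pMin) (hε : 0 < ε)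
    (hδ : 0 < δ) (hr : ∀ s, r s ∈ Set.Icc (0 : ℝ) 1) :
    |∫ ρ, singlePathMP r p ε δ ρ ∂M.runMeasure - M.meanPayoff r| ≤ ε + δ := by
  have hint := integrable_singlePathMP (p := p) (ε := ε) (δ := δ) hr M.runMeasure
  rcases le_or_gt 1 (ε + δ) with hbig | hsmall
  · have h1 := M.meanPayoff_mem_Icc hr
    have h2 : 0 ≤ ∫ ρ, singlePathMP r p ε δ ρ ∂M.runMeasure :=
      integral_nonneg fun ρ => (singlePathMP_mem_Icc hr ρ).1
    have h3 : ∫ ρ, singlePathMP r p ε δ ρ ∂M.runMeasure ≤ 1 := by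
      have := integral_mono hint (integrable_const (1 : ℝ))
        fun ρ => (singlePathMP_mem_Icc (p := p) (ε := ε) (δ := δ) hr ρ).2
      simpa using this
    exact abs_le.2 ⟨by linarith [h1.2], by linarith [h1.1]⟩
  obtain ⟨V, hV, hV0, hV1⟩ := exists_isSuperharmonic_of_error hp hpM hε (by linarith : ε < 1) hδ
    (by linarith : δ < 1) hr
  let bad : Set (ℕ → S) := {ρ | ∃ n, 1 ≤ V (pathTo ρ n)}
  let late : ℕ → Set (ℕ → S) := fun n => {ρ | ∀ m, m ≤ n → ¬ StopsAt p ε δ (pathTo ρ m)}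
  have hbadm : MeasurableSet bad := by
    simp only [bad, Set.ofPred_exists]
    exact .iUnion fun n => measurableSet_pathTo (fun π => 1 ≤ V π) n
  have hlatem : ∀ n, MeasurableSet (late n) := fun n => by
    simp only [late, Set.ofPred_forall]
    exact .iInter fun m => .iInter fun _ => measurableSet_pathTo (fun π => ¬ StopsAt p ε δ π) m
  have hbad : M.runMeasure.real bad ≤ δ :=
    ENNReal.toReal_le_of_le_ofReal hδ.le
      (hV.measure_exists_le.trans (ENNReal.ofReal_le_ofReal hV0))
  have hlate : Tendsto (fun n => M.runMeasure.real (late n)) atTop (𝓝 0) := by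
    have hanti : Antitone late := fun a b hab ρ hρ m hm => hρ m (hm.trans hab)
    have h := tendsto_measure_iInter_atTop (μ := M.runMeasure)
      (fun n => (hlatem n).nullMeasurableSet) hanti ⟨0, measure_ne_top _ _⟩
    have h0 : M.runMeasure (⋂ n, late n) = 0 := by
      refine measure_mono_null (fun ρ hρ => ?_) (ae_iff.1 (ae_terminates M p ε δ))
      rintro ⟨n, hn⟩
      exact Set.mem_iInter.1 hρ n n le_rfl hn
    rw [h0] at h
    exact (ENNReal.tendsto_toReal ENNReal.zero_ne_top).comp h
  have hbound : ∀ n, |∫ ρ, singlePathMP r p ε δ ρ ∂M.runMeasure - M.meanPayoff r|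
      ≤ ε + δ + M.runMeasure.real (late n) := by
    intro n
    have hg := M.integrable_eval (M.ergodicLimit r) n
    have hib : Integrable (bad.indicator fun _ => (1 : ℝ)) M.runMeasure :=
      (integrable_const 1).indicator hbadm
    have hil : Integrable ((late n).indicator fun _ => (1 : ℝ)) M.runMeasure :=
      (integrable_const 1).indicator (hlatem n)
    rw [← M.integral_ergodicLimit r n, ← integral_sub hint hg]
    refine (abs_integral_le_integral_abs).trans ?_
    calc ∫ ρ, |singlePathMP r p ε δ ρ - M.ergodicLimit r (ρ n)| ∂M.runMeasure
        ≤ ∫ ρ, (ε + bad.indicator (fun _ => (1 : ℝ)) ρ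
            + (late n).indicator (fun _ => (1 : ℝ)) ρ) ∂M.runMeasure := by
          refine integral_mono_ae (hint.sub hg).abs
            (((integrable_const ε).add hib).add hil) ?_
          filter_upwards [M.ae_P_pos] with ρ hρ
          have h1 := singlePathMP_mem_Icc (p := p) (ε := ε) (δ := δ) hr ρ
          have h2 : M.ergodicLimit r (ρ n) ∈ Set.Icc (0 : ℝ) 1 :=
            ⟨M.ergodicLimit_nonneg (fun s => (hr s).1) _,
              M.ergodicLimit_le_one (fun s => (hr s).2) _⟩
          have h3 : |singlePathMP r p ε δ ρ - M.ergodicLimit r (ρ n)| ≤ 1 :=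
            abs_le.2 ⟨by linarith [h1.1, h2.2], by linarith [h1.2, h2.1]⟩
          have hb0 : 0 ≤ bad.indicator (fun _ => (1 : ℝ)) ρ :=
            Set.indicator_nonneg (fun _ _ => zero_le_one) ρ
          have hl0 : 0 ≤ (late n).indicator (fun _ => (1 : ℝ)) ρ :=
            Set.indicator_nonneg (fun _ _ => zero_le_one) ρ
          by_cases hb : ρ ∈ bad
          · rw [Set.indicator_of_mem hb] at hb0 ⊢
            linarith
          by_cases hl : ρ ∈ late n
          · rw [Set.indicator_of_mem hl] at hl0 ⊢
            linarith
          have hlt : ∀ n, V (pathTo ρ n) < 1 := fun n => not_le.1 fun h => hb ⟨n, h⟩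
          simp only [late, Set.mem_ofPred_eq, not_forall, not_not] at hl
          obtain ⟨m, hmn, hm⟩ := hl
          linarith [hV1 ρ hρ hlt m n hmn hm]
      _ = ε + M.runMeasure.real bad + M.runMeasure.real (late n) := by
          have e1 := integral_add ((integrable_const ε).add hib) hil
          have e2 := integral_add (integrable_const ε) hib
          simp only [Pi.add_apply] at e1
          rw [e1, e2, integral_indicator_const _ hbadm, integral_indicator_const _ (hlatem n)]
          simp
      _ ≤ _ := by linarith
  have hlim := hlate.const_add (ε + δ)
  rw [add_zero] at hlim
  exact ge_of_tendsto' hlim hbound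

end PathGraph

/-! ### Correctness of the algorithm -/

theorem theorem5 {S : Type*} [Fintype S] [DecidableEq S] [MeasurableSpace S]
    [DiscreteMeasurableSpace S] (M : MarkovChain S) (r : S → ℝ)
    (hr : ∀ s, r s ∈ Set.Icc (0 : ℝ) 1) (p : ℝ) (hp : 0 < p) (hpM : p ≤ M.pMin)
    (ε δ : ℝ) (hε : 0 < ε) (hδ : 0 < δ) :
    Tendsto (fun n : ℕ => ∫ ρ, (1 / (n : ℝ)) * ∑ i ∈ Finset.Icc 1 n, r (ρ i) ∂M.runMeasure)
      atTop (𝓝 (M.meanPayoff r)) ∧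
    (∀ᵐ ρ ∂M.runMeasure, PathGraph.Terminates p ε δ ρ) ∧
    Integrable (PathGraph.singlePathMP r p ε δ) M.runMeasure ∧
    M.meanPayoff r - ε - δ ≤ ∫ ρ, PathGraph.singlePathMP r p ε δ ρ ∂M.runMeasure ∧
    ∫ ρ, PathGraph.singlePathMP r p ε δ ρ ∂M.runMeasure ≤ M.meanPayoff r + ε + δ ∧
    ∀ (Ω : Type*) [MeasurableSpace Ω] (ν : Measure Ω) [IsProbabilityMeasure ν]
      (a b : Ω → ℝ) (α : ℝ),
      1 - α ≤ ν.real {ω | ∫ ρ, PathGraph.singlePathMP r p ε δ ρ ∂M.runMeasure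
        ∈ Set.Icc (a ω) (b ω)} →
      1 - α ≤ ν.real {ω | M.meanPayoff r ∈ Set.Icc (a ω - ε - δ) (b ω + ε + δ)} := by
  have h := abs_le.1 (PathGraph.abs_integral_singlePathMP_sub_le hp hpM hε hδ hr)
  have hlim := M.tendsto_integral_average r
  rw [← M.meanPayoff_eq] at hlim
  refine ⟨hlim, PathGraph.ae_terminates M p ε δ, PathGraph.integrable_singlePathMP hr _,
    by linarith, by linarith, fun Ω _ ν _ a b α hα => hα.trans (measureReal_mono fun ω hω => ?_)⟩
  exact ⟨by linarith [hω.1], by linarith [hω.2]⟩
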